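/- Let $n\ge 0$ and let $A=A_n=\mathbb{C}\langle x_1,\dots,x_n\rangle$ be the free associative unital algebra. Put $[a,b]=ab-ba$, $L_1=A$, and let $L_{i+1}=[A,L_i]$ be the linear span of the elements $[a,l]$ with $a\in A$, $l\in L_i$. Let $M_i=A L_i A$ be the two-sided ideal generated by $L_i$, and put $B_i=L_i/L_{i+1}$ and $N_i=M_i/M_{i+1}$. Let $Z\subset B_1=A/[A,A]$ be the image of $M_3$, and $\overline{B}_1=B_1/Z$. Let $\Omega=\bigoplus_{k}\Omega^k=\mathbb{C}[x_1,\dots,x_n]\otimes\Lambda(dx_1,\dots,dx_n)$ be the algebra of polynomial differential forms on $\mathbb{C}^n$, with wedge product and de Rham differential $d$. Let $\Omega^{\rm even}=\bigoplus_{i\ge 0}\Omega^{2i}$, let $\Omega^{\rm even,+}=\bigoplus_{i\ge 1}\Omega^{2i}$, and let $\Omega^{\rm even}_{\rm exact}=\{\omega\in\Omega^{\rm even} : \omega=d\alpha \text{ for some } \alpha\in\Omega\}$. Let $\Omega^{\rm even}_*$ be the space $\Omega^{\rm even}$ with the associative product $\alpha*\beta=\alpha\wedge\beta+\tfrac12\,d\alpha\wedge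 d\beta$. The algebra homomorphism $\widetilde\phi:A\to\Omega^{\rm even}_*$ with $\widetilde\phi(x_i)=x_i$ kills $M_3$; let $\phi:A/M_3\to\Omega^{\rm even}_*$ be the induced homomorphism. **Theorem (Feigin–Shoikhet).** 1. $\phi$ is an algebra isomorphism. 2. $\phi(N_2)=\Omega^{\rm even,+}$, where $N_2=M_2/M_3\subset A/M_3$. 3. $L_2\cap M_3=L_3$; that is, the natural map $B_2=L_2/L_3\to A/M_3$ is injective, and so identifies $B_2$ with the image of $L_2$ in $A/M_3$. 4. Under this identification, $\phi(B_2)=\Omega^{\rm even}_{\rm exact}$. 5. $\phi$ induces a linear map $\hat\phi:B_1\to\Omega^{\rm even}/\Omega^{\rm even}_{\rm exact}$, $[a]\mapsto[\widetilde\phi(a)]$, with $\hat\phi(Z)=0$, and the resulting map $\overline\phi:\overline{B}_1\to\Omega^{\rm even}/\Omega^{\rm even}_{\rm exact}$ is an isomorphism. -/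

import Mathlib

open scoped TensorProduct

noncomputable section

namespace LowerCentral

section General

variable (R : Type*) [CommRing R] (A : Type*) [Ring A] [Algebra R A]

attribute [local instance] LieRing.ofAssociativeRing

/-- The lower central series `L₁ = A`, `L_{i+1} = [A, L_i]` (indexed from `1`) of the associative
algebra `A`, regarded as a Lie algebra with the commutator bracket. -/
def L (i : ℕ) : Submodule R A :=
  (LieModule.lowerCentralSeries R A A (i - 1)).toSubmodule

theorem L_one : L R A 1 = ⊤ := by simp [L]

theorem L_succ {i : ℕ} (hi : 1 ≤ i) :
    L R A (i + 1) = Submodule.span R {c | ∃ a : A, ∃ b ∈ L R A i, c = a * b - b * a} := by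
  obtain ⟨k, rfl⟩ := Nat.exists_eq_add_of_le' hi
  simp only [L, Nat.add_sub_cancel, LieModule.lowerCentralSeries_succ,
    LieSubmodule.lieIdeal_oper_eq_linear_span]
  congr 1
  ext c
  constructor
  · rintro ⟨a, b, rfl⟩
    exact ⟨a, b, b.2, rfl⟩
  · rintro ⟨a, b, hb, rfl⟩
    exact ⟨⟨a, LieSubmodule.mem_top a⟩, ⟨b, hb⟩, rfl⟩

/-- The two-sided ideal `M_i = A · L_i · A` generated by `L_i`. -/
def M (i : ℕ) : Ideal A :=
  TwoSidedIdeal.asIdeal (TwoSidedIdeal.span (L R A i : Set A))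

instance (i : ℕ) : (M R A i).IsTwoSided := by
  unfold M; infer_instance

/-- `B_i = L_i / L_{i+1}`. -/
abbrev B (i : ℕ) : Type _ := ↥(L R A i) ⧸ (L R A (i + 1)).submoduleOf (L R A i)

/-- `N_i = M_i / M_{i+1}`, as a subspace of `A / M_{i+1}`. -/
def N (i : ℕ) : Submodule R (A ⧸ M R A (i + 1)) :=
  ((M R A i).restrictScalars R).map (Ideal.Quotient.mkₐ R (M R A (i + 1))).toLinearMap

theorem L_le_M (i : ℕ) {a : A} (ha : a ∈ L R A i) : a ∈ M R A i :=
  TwoSidedIdeal.mem_asIdeal.2 (TwoSidedIdeal.subset_span ha)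

/-- The natural map `B_i = L_i / L_{i+1} → A / M_{i+1}`, `[a] ↦ [a]`. -/
def BToQuot (i : ℕ) : B R A i →ₗ[R] A ⧸ M R A (i + 1) :=
  Submodule.liftQ _ ((Ideal.Quotient.mkₐ R (M R A (i + 1))).toLinearMap ∘ₗ (L R A i).subtype)
    fun a ha => by
      have h : (a : A) ∈ M R A (i + 1) := L_le_M R A (i + 1) ha
      simpa [Ideal.Quotient.eq_zero_iff_mem] using h

/-- `B₁ = A / [A, A]`. -/
abbrev B₁ : Type _ := A ⧸ L R A 2

/-- `Z ⊆ B₁`, the image of `M₃` in `B₁`. -/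
def Z : Submodule R (B₁ R A) :=
  ((M R A 3).restrictScalars R).map (L R A 2).mkQ

/-- `B̄₁ = B₁ / Z`. -/
abbrev Bbar₁ : Type _ := B₁ R A ⧸ Z R A

end General

/-- Polynomial differential forms on `ℂⁿ`: `Ω = ℂ[x₁,…,xₙ] ⊗ Λ(dx₁,…,dxₙ)`; the multiplication
of this algebra is the wedge product. -/
abbrev Forms (n : ℕ) : Type :=
  MvPolynomial (Fin n) ℂ ⊗[ℂ] ExteriorAlgebra ℂ (Fin n → ℂ)

variable {n : ℕ}

/-- The one-form `dx_i`. -/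
def dx (i : Fin n) : Forms n :=
  1 ⊗ₜ ExteriorAlgebra.ι ℂ (Pi.single i 1)

/-- The partial derivative `∂/∂x_i` acting on the coefficients of a form. -/
def partialD (i : Fin n) : Forms n →ₗ[ℂ] Forms n :=
  (MvPolynomial.pderiv i : Derivation ℂ (MvPolynomial (Fin n) ℂ) _).toLinearMap.rTensor _

/-- The de Rham differential `dα = ∑ dx_i ∧ ∂α/∂x_i`. -/
def d : Forms n →ₗ[ℂ] Forms n :=
  ∑ i, LinearMap.mulLeft ℂ (dx i) ∘ₗ partialD i

variable (n) in
/-- The space `Ωᵏ = ℂ[x₁,…,xₙ] ⊗ Λᵏ` of forms of degree `k` (zero for `k > n`). -/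
def formsDeg (k : ℕ) : Submodule ℂ (Forms n) :=
  LinearMap.range ((⋀[ℂ]^k (Fin n → ℂ)).subtype.lTensor (MvPolynomial (Fin n) ℂ))

variable (n) in
/-- The space `⨁ Ω²ⁱ` of even forms. -/
def evenForms : Submodule ℂ (Forms n) := ⨆ i : ℕ, formsDeg n (2 * i)

variable (n) in
/-- The space of even forms of positive degree, `⨁_{i ≥ 1} Ω²ⁱ`. -/
def evenPosForms : Submodule ℂ (Forms n) := ⨆ i : ℕ, formsDeg n (2 * (i + 1))

/-! ### Facts needed for the product on even forms -/

theorem d_apply (α : Forms n) : d α = ∑ i, dx i * partialD i α := by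
  simp [d]

theorem partialD_tmul (i : Fin n) (p : MvPolynomial (Fin n) ℂ)
    (w : ExteriorAlgebra ℂ (Fin n → ℂ)) :
    partialD i (p ⊗ₜ[ℂ] w) = MvPolynomial.pderiv i p ⊗ₜ w := rfl

theorem partialD_mul (i : Fin n) (α β : Forms n) :
    partialD i (α * β) = partialD i α * β + α * partialD i β := by
  induction α using TensorProduct.induction_on with
  | zero => simp
  | add a b ha hb => simp only [add_mul, map_add, ha, hb]; abel
  | tmul p w =>
    induction β using TensorProduct.induction_on with
    | zero => simp
    | add a b ha hb => simp only [mul_add, map_add, ha, hb]; abel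
    | tmul q v =>
      rw [Algebra.TensorProduct.tmul_mul_tmul, partialD_tmul, partialD_tmul, partialD_tmul,
        Algebra.TensorProduct.tmul_mul_tmul, Algebra.TensorProduct.tmul_mul_tmul,
        ← TensorProduct.add_tmul, Derivation.leibniz, smul_eq_mul, smul_eq_mul, add_comm,
        mul_comm q]

theorem partialD_dx (i j : Fin n) : partialD i (dx j) = 0 := by
  simp [dx, partialD_tmul]

theorem pderiv_comm (i j : Fin n) (p : MvPolynomial (Fin n) ℂ) :
    MvPolynomial.pderiv i (MvPolynomial.pderiv j p) =
      MvPolynomial.pderiv j (MvPolynomial.pderiv i p) := by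
  have h : ⁅(MvPolynomial.pderiv i : Derivation ℂ (MvPolynomial (Fin n) ℂ) _),
      (MvPolynomial.pderiv j : Derivation ℂ (MvPolynomial (Fin n) ℂ) _)⁆ = 0 := by
    apply MvPolynomial.derivation_ext
    intro k
    rw [Derivation.commutator_apply]
    simp [MvPolynomial.pderiv_X, Pi.single_apply, apply_ite]
  have h2 := congrArg (fun D : Derivation ℂ (MvPolynomial (Fin n) ℂ) _ => D p) h
  simpa [Derivation.commutator_apply, sub_eq_zero] using h2

theorem partialD_comm (i j : Fin n) (α : Forms n) :
    partialD i (partialD j α) = partialD j (partialD i α) := by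
  induction α using TensorProduct.induction_on with
  | zero => simp
  | add a b ha hb => simp only [map_add, ha, hb]
  | tmul p w =>
    rw [partialD_tmul, partialD_tmul, partialD_tmul, partialD_tmul, pderiv_comm]

theorem dx_mul_dx (i j : Fin n) : dx i * dx j = -(dx j * dx i) := by
  rw [eq_neg_iff_add_eq_zero]
  simp only [dx, Algebra.TensorProduct.tmul_mul_tmul, ← TensorProduct.tmul_add,
    ExteriorAlgebra.ι_add_mul_swap, TensorProduct.tmul_zero]

theorem d_d (α : Forms n) : d (d α) = 0 := by
  have h : d (d α) = ∑ i, ∑ j, dx i * dx j * partialD i (partialD j α) := by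
    rw [d_apply (d α)]
    refine Finset.sum_congr rfl fun i _ => ?_
    rw [d_apply α, map_sum, Finset.mul_sum]
    refine Finset.sum_congr rfl fun j _ => ?_
    rw [partialD_mul, partialD_dx, zero_mul, zero_add, mul_assoc]
  have h2 : d (d α) = -d (d α) := by
    conv_lhs => rw [h, Finset.sum_comm]
    rw [h, ← Finset.sum_neg_distrib]
    refine Finset.sum_congr rfl fun i _ => ?_
    rw [← Finset.sum_neg_distrib]
    refine Finset.sum_congr rfl fun j _ => ?_
    rw [dx_mul_dx, partialD_comm]
    exact neg_mul (dx i * dx j) _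
  have h3 : (2 : ℂ) • d (d α) = 0 := by
    rw [two_smul]
    exact add_eq_zero_iff_eq_neg.2 h2
  exact (smul_eq_zero.1 h3).resolve_left two_ne_zero

theorem tmul_mem_formsDeg {k : ℕ} (p : MvPolynomial (Fin n) ℂ)
    {w : ExteriorAlgebra ℂ (Fin n → ℂ)} (hw : w ∈ ⋀[ℂ]^k (Fin n → ℂ)) :
    p ⊗ₜ w ∈ formsDeg n k :=
  ⟨p ⊗ₜ ⟨w, hw⟩, rfl⟩

theorem formsDeg_induction {k : ℕ} {P : Forms n → Prop} (h0 : P 0)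
    (hadd : ∀ a b, P a → P b → P (a + b))
    (ht : ∀ p w, w ∈ ⋀[ℂ]^k (Fin n → ℂ) → P (p ⊗ₜ w)) {α : Forms n}
    (hα : α ∈ formsDeg n k) : P α := by
  obtain ⟨t, rfl⟩ := hα
  induction t using TensorProduct.induction_on with
  | zero => simpa using h0
  | add a b ha hb => rw [map_add]; exact hadd _ _ ha hb
  | tmul p w => exact ht p w w.2

theorem formsDeg_mul {k l : ℕ} {α β : Forms n} (hα : α ∈ formsDeg n k)
    (hβ : β ∈ formsDeg n l) : α * β ∈ formsDeg n (k + l) := by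
  refine formsDeg_induction (P := fun α => α * β ∈ formsDeg n (k + l)) (by simp)
    (fun a b ha hb => by rw [add_mul]; exact add_mem ha hb) (fun p w hw => ?_) hα
  refine formsDeg_induction (P := fun β => (p ⊗ₜ w) * β ∈ formsDeg n (k + l)) (by simp)
    (fun a b ha hb => by rw [mul_add]; exact add_mem ha hb) (fun q v hv => ?_) hβ
  rw [Algebra.TensorProduct.tmul_mul_tmul]
  exact tmul_mem_formsDeg _ (SetLike.mul_mem_graded hw hv)

theorem dx_mem (i : Fin n) : dx i ∈ formsDeg n 1 :=
  tmul_mem_formsDeg _ (by simp)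

theorem partialD_mem (i : Fin n) {k : ℕ} {α : Forms n} (hα : α ∈ formsDeg n k) :
    partialD i α ∈ formsDeg n k :=
  formsDeg_induction (P := fun α => partialD i α ∈ formsDeg n k) (by simp)
    (fun a b ha hb => by rw [map_add]; exact add_mem ha hb)
    (fun p w hw => tmul_mem_formsDeg _ hw) hα

theorem d_mem {k : ℕ} {α : Forms n} (hα : α ∈ formsDeg n k) : d α ∈ formsDeg n (k + 1) := by
  rw [d_apply]
  refine sum_mem fun i _ => ?_
  rw [add_comm]
  exact formsDeg_mul (dx_mem i) (partialD_mem i hα)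

theorem evenForms_induction {P : Forms n → Prop} (h0 : P 0)
    (hadd : ∀ a b, P a → P b → P (a + b)) (h : ∀ k, ∀ α ∈ formsDeg n (2 * k), P α)
    {α : Forms n} (hα : α ∈ evenForms n) : P α :=
  Submodule.iSup_induction (motive := P) _ hα h h0 hadd

theorem formsDeg_le_evenForms (k : ℕ) : formsDeg n (2 * k) ≤ evenForms n :=
  le_iSup (fun k => formsDeg n (2 * k)) k

theorem evenForms_mul {α β : Forms n} (hα : α ∈ evenForms n) (hβ : β ∈ evenForms n) :
    α * β ∈ evenForms n := by
  refine evenForms_induction (P := fun α => α * β ∈ evenForms n) (by simp)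
    (fun a b ha hb => by rw [add_mul]; exact add_mem ha hb) (fun k α hα => ?_) hα
  refine evenForms_induction (P := fun β => α * β ∈ evenForms n) (by simp)
    (fun a b ha hb => by rw [mul_add]; exact add_mem ha hb) (fun l β hβ => ?_) hβ
  have := formsDeg_mul hα hβ
  rw [← mul_add] at this
  exact formsDeg_le_evenForms _ this

theorem d_mul_d_mem {α β : Forms n} (hα : α ∈ evenForms n) (hβ : β ∈ evenForms n) :
    d α * d β ∈ evenForms n := by
  refine evenForms_induction (P := fun α => d α * d β ∈ evenForms n) (by simp)
    (fun a b ha hb => by rw [map_add, add_mul]; exact add_mem ha hb) (fun k α hα => ?_) hα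
  refine evenForms_induction (P := fun β => d α * d β ∈ evenForms n) (by simp)
    (fun a b ha hb => by rw [map_add, mul_add]; exact add_mem ha hb) (fun l β hβ => ?_) hβ
  have := formsDeg_mul (d_mem hα) (d_mem hβ)
  rw [show 2 * k + 1 + (2 * l + 1) = 2 * (k + l + 1) by ring] at this
  exact formsDeg_le_evenForms _ this

theorem mem_evenForms_of_poly (p : MvPolynomial (Fin n) ℂ) :
    (p ⊗ₜ 1 : Forms n) ∈ evenForms n :=
  formsDeg_le_evenForms 0 (tmul_mem_formsDeg p (by simp))

theorem one_mem_evenForms : (1 : Forms n) ∈ evenForms n := mem_evenForms_of_poly 1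

theorem wedge_ι_comm {k : ℕ} {w : ExteriorAlgebra ℂ (Fin n → ℂ)}
    (hw : w ∈ ⋀[ℂ]^k (Fin n → ℂ)) (v : Fin n → ℂ) :
    w * ExteriorAlgebra.ι ℂ v = (-1 : ℂ) ^ k • (ExteriorAlgebra.ι ℂ v * w) := by
  induction hw using Submodule.pow_induction_on_left' with
  | algebraMap r => simp [Algebra.commutes]
  | add x y i hx hy ihx ihy => rw [add_mul, ihx, ihy, mul_add, smul_add]
  | mem_mul m hm i x hx ih =>
    obtain ⟨u, rfl⟩ := hm
    rw [mul_assoc, ih, mul_smul_comm, ← mul_assoc,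
      eq_neg_of_add_eq_zero_left (ExteriorAlgebra.ι_add_mul_swap u v), pow_succ, mul_neg_one,
      neg_smul, neg_mul, smul_neg, mul_assoc]

theorem wedge_comm {k : ℕ} {w : ExteriorAlgebra ℂ (Fin n → ℂ)}
    (hw : w ∈ ⋀[ℂ]^(2 * k) (Fin n → ℂ)) (v : ExteriorAlgebra ℂ (Fin n → ℂ)) :
    w * v = v * w := by
  induction v using ExteriorAlgebra.induction with
  | algebraMap r => exact (Algebra.commutes r w).symm
  | ι u => rw [wedge_ι_comm hw, pow_mul, neg_one_sq, one_pow, one_smul]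
  | mul a b ha hb => rw [← mul_assoc, ha, mul_assoc, hb, mul_assoc]
  | add a b ha hb => rw [mul_add, ha, hb, add_mul]

theorem evenForms_comm {α : Forms n} (hα : α ∈ evenForms n) (β : Forms n) :
    α * β = β * α := by
  refine evenForms_induction (P := fun α => α * β = β * α) (by simp)
    (fun a b ha hb => by rw [add_mul, ha, hb, mul_add]) (fun k α hα => ?_) hα
  refine formsDeg_induction (P := fun α => α * β = β * α) (by simp)
    (fun a b ha hb => by rw [add_mul, ha, hb, mul_add]) (fun p w hw => ?_) hα
  induction β using TensorProduct.induction_on with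
  | zero => simp
  | add a b ha hb => rw [mul_add, ha, hb, add_mul]
  | tmul q v =>
    rw [Algebra.TensorProduct.tmul_mul_tmul, Algebra.TensorProduct.tmul_mul_tmul,
      wedge_comm hw, mul_comm]

theorem d_mul {α : Forms n} (hα : α ∈ evenForms n) (β : Forms n) :
    d (α * β) = d α * β + α * d β := by
  simp only [d_apply, partialD_mul, mul_add, Finset.sum_add_distrib, Finset.sum_mul,
    Finset.mul_sum]
  congr 1
  · simp only [mul_assoc]
  · refine Finset.sum_congr rfl fun i _ => ?_
    rw [← mul_assoc, ← mul_assoc, evenForms_comm hα]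

theorem d_d_mul_d {α : Forms n} (hα : α ∈ evenForms n) (β : Forms n) :
    d (d α * d β) = 0 := by
  have h : d α * d β = d (α * d β) := by rw [d_mul hα, d_d, mul_zero, add_zero]
  rw [h, d_d]

theorem d_one : d (1 : Forms n) = 0 := by
  simp [d_apply, Algebra.TensorProduct.one_def, partialD_tmul]

/-! ### The algebra of even forms with the product `α ∗ β = α ∧ β + ½ dα ∧ dβ` -/

variable (n) in
/-- The vector space of even forms, to be endowed with the product `∗`. -/
def EvenStar : Type := ↥(evenForms n)

instance : AddCommGroup (EvenStar n) := inferInstanceAs (AddCommGroup ↥(evenForms n))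

instance : Module ℂ (EvenStar n) := inferInstanceAs (Module ℂ ↥(evenForms n))

variable (n) in
/-- The inclusion of even forms into all forms. -/
def toForm : EvenStar n →ₗ[ℂ] Forms n := (evenForms n).subtype

theorem toForm_injective : Function.Injective (toForm n) := Subtype.val_injective

/-- The product `α ∗ β = α ∧ β + ½ dα ∧ dβ`. -/
instance : Mul (EvenStar n) where
  mul α β := ⟨toForm n α * toForm n β + (1 / 2 : ℂ) • (d (toForm n α) * d (toForm n β)),
    add_mem (evenForms_mul α.2 β.2) (Submodule.smul_mem _ _ (d_mul_d_mem α.2 β.2))⟩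

instance : One (EvenStar n) := ⟨⟨1, one_mem_evenForms⟩⟩

theorem toForm_mul (α β : EvenStar n) : toForm n (α * β) =
    toForm n α * toForm n β + (1 / 2 : ℂ) • (d (toForm n α) * d (toForm n β)) := rfl

theorem toForm_one : toForm n 1 = 1 := rfl

theorem toForm_mem (α : EvenStar n) : toForm n α ∈ evenForms n := α.2

theorem d_toForm_mul (α β : EvenStar n) : d (toForm n (α * β)) =
    d (toForm n α) * toForm n β + toForm n α * d (toForm n β) := by
  rw [toForm_mul, map_add, map_smul, d_mul (toForm_mem α), d_d_mul_d (toForm_mem α), smul_zero,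
    add_zero]

theorem star_assoc (α β γ : EvenStar n) : α * β * γ = α * (β * γ) := by
  apply toForm_injective
  simp only [toForm_mul, map_add, map_smul, d_mul (toForm_mem _), d_d_mul_d (toForm_mem _),
    smul_zero, add_zero, add_mul, mul_add, smul_add, smul_mul_assoc, mul_smul_comm, mul_assoc]
  abel

instance : Ring (EvenStar n) where
  __ := (inferInstance : AddCommGroup (EvenStar n))
  mul_assoc := star_assoc
  one_mul α := toForm_injective (by simp [toForm_mul, toForm_one, d_one])
  mul_one α := toForm_injective (by simp [toForm_mul, toForm_one, d_one])
  zero_mul α := toForm_injective (by simp [toForm_mul])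
  mul_zero α := toForm_injective (by simp [toForm_mul])
  left_distrib α β γ := toForm_injective (by
    simp only [toForm_mul, map_add, mul_add, smul_add]; abel)
  right_distrib α β γ := toForm_injective (by
    simp only [toForm_mul, map_add, add_mul, smul_add]; abel)

instance : Algebra ℂ (EvenStar n) :=
  Algebra.ofModule
    (fun r α β => toForm_injective (by
      simp only [toForm_mul, map_smul, smul_mul_assoc, smul_add, smul_comm r]))
    (fun r α β => toForm_injective (by
      simp only [toForm_mul, map_smul, mul_smul_comm, smul_add, smul_comm r]))

/-- The coordinate function `x_i`, as a form of degree zero. -/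
def x (i : Fin n) : EvenStar n :=
  ⟨MvPolynomial.X i ⊗ₜ 1, mem_evenForms_of_poly _⟩

variable (n) in
/-- The even forms of positive degree. -/
def evenPos : Submodule ℂ (EvenStar n) := (evenPosForms n).comap (toForm n)

variable (n) in
/-- The even exact forms: even forms `ω` such that `ω = dα` for some form `α`. -/
def evenExact : Submodule ℂ (EvenStar n) := (LinearMap.range (d (n := n))).comap (toForm n)

variable (n) in
/-- The free algebra `A_n`. -/
abbrev FreeAlg : Type := FreeAlgebra ℂ (Fin n)

variable (n) in
/-- The algebra homomorphism `A_n → Ω_∗^even`, `x_i ↦ x_i`. -/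
def phiTilde : FreeAlg n →ₐ[ℂ] EvenStar n := FreeAlgebra.lift ℂ x

theorem phiTilde_eq_zero {a : FreeAlg n} (ha : a ∈ M ℂ (FreeAlg n) 3) : phiTilde n a = 0 := by
  have hL2 : ∀ b ∈ L ℂ (FreeAlg n) 2, d (toForm n (phiTilde n b)) = 0 := by
    intro b hb
    rw [L_succ ℂ _ le_rfl] at hb
    induction hb using Submodule.span_induction with
    | mem c hc =>
      obtain ⟨a, b, -, rfl⟩ := hc
      simp only [map_sub, map_mul, d_toForm_mul]
      rw [evenForms_comm (toForm_mem (phiTilde n a)), evenForms_comm (toForm_mem (phiTilde n b))]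
      abel
    | zero => simp
    | add b c _ _ hb hc => simp only [map_add, hb, hc, add_zero]
    | smul r b _ hb => simp only [map_smul, hb, smul_zero]
  have hL3 : ∀ c ∈ L ℂ (FreeAlg n) 3, phiTilde n c = 0 := by
    intro c hc
    rw [L_succ ℂ _ one_le_two] at hc
    induction hc using Submodule.span_induction with
    | mem c hc =>
      obtain ⟨a, b, hb, rfl⟩ := hc
      apply toForm_injective
      simp only [map_sub, map_mul, toForm_mul, hL2 b hb]
      simp [evenForms_comm (toForm_mem (phiTilde n a))]
    | zero => simp
    | add b c _ _ hb hc => simp only [map_add, hb, hc, add_zero]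
    | smul r b _ hb => simp only [map_smul, hb, smul_zero]
  have h : TwoSidedIdeal.span (L ℂ (FreeAlg n) 3 : Set (FreeAlg n)) ≤
      TwoSidedIdeal.ker (phiTilde n) :=
    TwoSidedIdeal.span_le.2 fun c hc => (TwoSidedIdeal.mem_ker _).2 (hL3 c hc)
  exact (TwoSidedIdeal.mem_ker _).1 (h (TwoSidedIdeal.mem_asIdeal.1 ha))

variable (n) in
/-- The induced homomorphism `φ : A_n / M₃ → Ω_∗^even`. -/
def phi : (FreeAlg n ⧸ M ℂ (FreeAlg n) 3) →ₐ[ℂ] EvenStar n :=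
  Ideal.Quotient.liftₐ _ (phiTilde n) fun _ ha => phiTilde_eq_zero ha

end LowerCentral

end

/-!
Everything rests on the fact that commutators are central in `Q = A / M₃`, as they are in
`Ω_∗^even`, where `[α, β] = dα ∧ dβ` and closed forms are central.

For `φ` to be onto, note that `x_i ∧ α` is the Jordan product `½(x_i ∗ α + α ∗ x_i)` and that
`dx_i ∧ dx_j ∧ α` is `α ∗ [x_i, x_j]` (`exists_formOf_eq`). For injectivity a linear inverse is
built: on any algebra with central commutators the Jordan product is associative, so polynomials
can be evaluated in it, while `[a, b][b, c] = 0`, so that the even part of the exterior algebra maps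
to `Q` by `dx_i ∧ dx_j ↦ [x_i, x_j]`; the product of these two maps inverts `φ`
(`exists_linear_factorization`). The image of `M₂` is then the ideal generated by the forms
`dx_i ∧ dx_j`, and the image of `L₂` is spanned by the forms `dα ∧ dβ` with `α`, `β` even, which are
all the even exact forms because every odd form is a sum of forms `α ∧ dx_i`
(`map_M_two`, `map_L_two`).

The remaining point is `L₂ ∩ M₃ ⊆ L₃` (`mem_L_three`). A computation with commutators
(`commutator_mul_commutator_add_swap_mem`) shows that `[a [b, c], e]` is antisymmetric in `c` and
`e` modulo `L₃`, hence that `[M₃, A] ⊆ L₃`. The commutator modulo `L₃` is therefore a bracket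
`{α, β}` of even forms (`exists_bracket`). It is skew, kills exact forms, and satisfies
`{α, βγ} = {αβ, γ} + {αγ, β}`, so it obeys the chain rule `{α, β} = ∑ {α ∂_iβ, x_i}`; by the
antisymmetry, `{α, x_i}` depends only on the odd form `dx_i ∧ α`. So there is a linear functional
`η` on forms with `η(α ∧ dβ) = {α, β}` for even `α`, `β` (`exists_odd_functional`), and
`η(dβ) = {1, β} = 0`. If `l = ∑ [a_i, b_i]` is killed by `φ̃`, then the odd form
`∑ φ̃(a_i) ∧ dφ̃(b_i)` is closed, so it is exact by the Poincaré lemma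
(`exists_even_of_d_eq_zero`), and applying `η` gives `l ∈ L₃`.
-/

noncomputable section

namespace LowerCentral

/-! ### Commutators modulo `L₃` -/

section Commutators

variable {R : Type*} [CommRing R] {A : Type*} [Ring A] [Algebra R A]

theorem commutator_mem_L_succ {i : ℕ} (hi : 1 ≤ i) (a : A) {b : A} (hb : b ∈ L R A i) :
    a * b - b * a ∈ L R A (i + 1) := by
  rw [L_succ R A hi]
  exact Submodule.subset_span ⟨a, b, hb, rfl⟩

theorem commutator_mem_L_two (a b : A) : a * b - b * a ∈ L R A 2 :=
  commutator_mem_L_succ le_rfl a (by simp [L_one])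

theorem commutator_mem_L_three (a : A) {b : A} (hb : b ∈ L R A 2) :
    a * b - b * a ∈ L R A 3 :=
  commutator_mem_L_succ one_le_two a hb

theorem commutator_mem_L_three' (a : A) {b : A} (hb : b ∈ L R A 2) :
    b * a - a * b ∈ L R A 3 := by
  rw [← neg_sub]; exact neg_mem (commutator_mem_L_three a hb)

theorem L_three_le_L_two : L R A 3 ≤ L R A 2 := by
  rw [L_succ R A one_le_two, Submodule.span_le]
  rintro _ ⟨a, b, -, rfl⟩
  exact commutator_mem_L_two a b

/-- Modulo `L₃`, the expression `[y X, z]` with `X ∈ L₂` is antisymmetric in `y` and `z`. -/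
theorem commutator_mul_add_swap_mem {X : A} (hX : X ∈ L R A 2) (y z : A) :
    (y * X * z - z * (y * X)) + (z * X * y - y * (z * X)) ∈ L R A 3 := by
  have h1 := commutator_mem_L_three (R := R) (y * z) hX
  have h2 := commutator_mem_L_three (R := R) z (commutator_mem_L_two (R := R) X y)
  have : (y * X * z - z * (y * X)) + (z * X * y - y * (z * X)) =
      (z * (X * y - y * X) - (X * y - y * X) * z) - (y * z * X - X * (y * z)) := by noncomm_ring
  rw [this]
  exact sub_mem h2 h1

/-- Modulo `L₃`, the expression `[a [b, c], e]` is antisymmetric in `c` and `e`. -/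
theorem commutator_mul_commutator_add_swap_mem (a b c e : A) :
    (a * (b * c - c * b) * e - e * (a * (b * c - c * b))) +
      (a * (b * e - e * b) * c - c * (a * (b * e - e * b))) ∈ L R A 3 := by
  -- modulo `L₂` one may rotate `a [b, c]` into `c [a, b]`
  have rot : ∀ u v : A, (a * (b * u - u * b) * v - v * (a * (b * u - u * b))) -
      (u * (a * b - b * a) * v - v * (u * (a * b - b * a))) ∈ L R A 3 := by
    intro u v
    have hm : a * (b * u - u * b) - u * (a * b - b * a) ∈ L R A 2 := by
      have : a * (b * u - u * b) - u * (a * b - b * a) =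
          (a * b * u - u * (a * b)) - (a * u * b - u * b * a) := by noncomm_ring
      rw [this, show a * u * b - u * b * a = a * (u * b) - u * b * a by noncomm_ring]
      exact sub_mem (commutator_mem_L_two _ _) (commutator_mem_L_two _ _)
    have := commutator_mem_L_three' (R := R) v hm
    convert this using 1
    noncomm_ring
  have h := commutator_mul_add_swap_mem (R := R) (commutator_mem_L_two (R := R) a b) c e
  convert add_mem (add_mem (rot c e) (rot e c)) h using 1
  abel

/-- `[M₃, A] ⊆ L₃`. -/
theorem commutator_mem_L_three_of_mem_M_three {m : A} (hm : m ∈ M R A 3) (e : A) :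
    m * e - e * m ∈ L R A 3 := by
  have hL : ∀ l ∈ L R A 3, ∀ a e : A, a * l * e - e * (a * l) ∈ L R A 3 := by
    intro l hl
    rw [L_succ R A one_le_two] at hl
    induction hl using Submodule.span_induction with
    | mem c hc =>
      obtain ⟨b, y, hy, rfl⟩ := hc
      intro a e
      have h1 := commutator_mul_commutator_add_swap_mem (R := R) a b y e
      have h2 := commutator_mem_L_three' (R := R) (a * (b * e - e * b)) hy
      convert add_mem h1 h2 using 1
      abel
    | zero => intro a e; simp
    | add x y _ _ hx hy =>
      intro a e
      convert add_mem (hx a e) (hy a e) using 1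
      noncomm_ring
    | smul r x _ hx =>
      intro a e
      convert Submodule.smul_mem _ r (hx a e) using 1
      simp [smul_sub]
  suffices h : ∀ a e : A, a * m * e - e * (a * m) ∈ L R A 3 by simpa using h 1 e
  have hm' : m ∈ TwoSidedIdeal.span (L R A 3 : Set A) := TwoSidedIdeal.mem_asIdeal.1 hm
  clear hm
  induction hm' using TwoSidedIdeal.span_induction with
  | mem l hl => exact hL l hl
  | zero => intro a e; simp
  | add x y _ _ hx hy =>
    intro a e
    convert add_mem (hx a e) (hy a e) using 1
    noncomm_ring
  | neg x _ hx =>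
    intro a e
    convert neg_mem (hx a e) using 1
    noncomm_ring
  | left_absorb b x _ hx =>
    intro a e
    simpa [mul_assoc] using hx (a * b) e
  | right_absorb b x _ hx =>
    intro a e
    -- `a x b` and `b a x` differ by an element of `L₂`
    have h1 := commutator_mem_L_three' (R := R) e (commutator_mem_L_two (R := R) (a * x) b)
    convert add_mem (hx (b * a) e) h1 using 1
    noncomm_ring

end Commutators

/-! ### Contractions, parity and rescalings of forms -/

section FormCalculus

variable {n : ℕ}

/-- The coordinate function `x_i`, as a form. -/
def coord (i : Fin n) : Forms n := MvPolynomial.X i ⊗ₜ 1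

/-- The contraction of forms with the constant vector field `∂/∂x_i`. -/
def contract (i : Fin n) : Forms n →ₗ[ℂ] Forms n :=
  (CliffordAlgebra.contractLeft (Q := (0 : QuadraticForm ℂ (Fin n → ℂ)))
    (LinearMap.proj i)).lTensor _

theorem contract_tmul (i : Fin n) (p : MvPolynomial (Fin n) ℂ)
    (w : ExteriorAlgebra ℂ (Fin n → ℂ)) :
    contract i (p ⊗ₜ[ℂ] w) = p ⊗ₜ (CliffordAlgebra.contractLeft
      (Q := (0 : QuadraticForm ℂ (Fin n → ℂ))) (LinearMap.proj i) w) := rfl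

theorem ι_eq_sum (u : Fin n → ℂ) :
    ExteriorAlgebra.ι ℂ u = ∑ i, u i • ExteriorAlgebra.ι ℂ (Pi.single i 1 : Fin n → ℂ) := by
  conv_lhs => rw [pi_eq_sum_univ' u]
  rw [map_sum]
  refine Finset.sum_congr rfl fun i _ => ?_
  rw [map_smul]

theorem contractLeft_mem {k : ℕ} (f : Module.Dual ℂ (Fin n → ℂ))
    {w : ExteriorAlgebra ℂ (Fin n → ℂ)} (hw : w ∈ ⋀[ℂ]^(k + 1) (Fin n → ℂ)) :
    CliffordAlgebra.contractLeft (Q := (0 : QuadraticForm ℂ (Fin n → ℂ))) f w ∈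
      ⋀[ℂ]^k (Fin n → ℂ) := by
  have key : ∀ j, ∀ w ∈ ⋀[ℂ]^j (Fin n → ℂ), ∀ k, j = k + 1 →
      CliffordAlgebra.contractLeft (Q := (0 : QuadraticForm ℂ (Fin n → ℂ))) f w ∈
        ⋀[ℂ]^k (Fin n → ℂ) := by
    intro j w hw
    induction hw using Submodule.pow_induction_on_left' with
    | algebraMap r => intro k hk; omega
    | add x y i hx hy ihx ihy =>
      intro k hk
      rw [map_add]
      exact add_mem (ihx k hk) (ihy k hk)
    | mem_mul m hm i x hx ih =>
      intro k hk
      obtain rfl : i = k := by omega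
      obtain ⟨u, rfl⟩ := hm
      erw [CliffordAlgebra.contractLeft_ι_mul]
      refine sub_mem (Submodule.smul_mem _ _ hx) ?_
      cases i with
      | zero =>
        obtain ⟨r, rfl⟩ := Submodule.mem_one.1 (by simpa using hx)
        erw [CliffordAlgebra.contractLeft_algebraMap]
        simp
      | succ i =>
        change _ ∈ LinearMap.range (ExteriorAlgebra.ι ℂ) ^ (i + 1)
        rw [pow_succ']
        exact Submodule.mul_mem_mul ⟨u, rfl⟩ (ih i rfl)
  exact key _ w hw k rfl

/-- Euler's identity in the exterior algebra: the operator `∑ e_i ∧ ι_i` is the degree. -/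
theorem sum_ι_mul_contractLeft {k : ℕ}
    {w : ExteriorAlgebra ℂ (Fin n → ℂ)} (hw : w ∈ ⋀[ℂ]^k (Fin n → ℂ)) :
    ∑ i, ExteriorAlgebra.ι ℂ (Pi.single i 1 : Fin n → ℂ) * CliffordAlgebra.contractLeft
      (Q := (0 : QuadraticForm ℂ (Fin n → ℂ))) (LinearMap.proj i) w = (k : ℂ) • w := by
  induction hw using Submodule.pow_induction_on_left' with
  | algebraMap r =>
    simp only [Nat.cast_zero, zero_smul]
    refine Finset.sum_eq_zero fun i _ => ?_
    erw [CliffordAlgebra.contractLeft_algebraMap]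
    exact mul_zero _
  | add x y i hx hy ihx ihy =>
    simp only [map_add, mul_add, Finset.sum_add_distrib, smul_add]
    rw [ihx, ihy]
  | mem_mul m hm k x hx ih =>
    obtain ⟨u, rfl⟩ := hm
    have h : ∀ i : Fin n, ExteriorAlgebra.ι ℂ (Pi.single i 1 : Fin n → ℂ) *
        CliffordAlgebra.contractLeft (Q := (0 : QuadraticForm ℂ (Fin n → ℂ)))
          (LinearMap.proj i) (ExteriorAlgebra.ι ℂ u * x) =
        (u i • ExteriorAlgebra.ι ℂ (Pi.single i 1 : Fin n → ℂ)) * x +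
        ExteriorAlgebra.ι ℂ u * (ExteriorAlgebra.ι ℂ (Pi.single i 1 : Fin n → ℂ) *
          CliffordAlgebra.contractLeft (Q := (0 : QuadraticForm ℂ (Fin n → ℂ)))
            (LinearMap.proj i) x) := by
      intro i
      erw [CliffordAlgebra.contractLeft_ι_mul]
      rw [mul_sub, ← mul_assoc _ (CliffordAlgebra.ι _ u)]
      rw [eq_neg_of_add_eq_zero_left
        (ExteriorAlgebra.ι_add_mul_swap (R := ℂ) (Pi.single i 1 : Fin n → ℂ) u :
          _ * CliffordAlgebra.ι _ u + CliffordAlgebra.ι _ u * _ = 0)]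
      rw [neg_mul, sub_neg_eq_add, mul_assoc, mul_smul_comm, smul_mul_assoc]
      rfl
    simp only [h, Finset.sum_add_distrib, ← Finset.sum_mul, ← Finset.mul_sum, ← ι_eq_sum, ih]
    rw [mul_smul_comm]
    push_cast
    rw [add_smul, one_smul, add_comm]

theorem contract_mem (i : Fin n) {k : ℕ} {α : Forms n} (hα : α ∈ formsDeg n (k + 1)) :
    contract i α ∈ formsDeg n k :=
  formsDeg_induction (P := fun α => contract i α ∈ formsDeg n k) (by simp)
    (fun a b ha hb => by rw [map_add]; exact add_mem ha hb)
    (fun p w hw => tmul_mem_formsDeg _ (contractLeft_mem _ hw)) hα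

theorem contract_dx_mul (i j : Fin n) (α : Forms n) :
    contract i (dx j * α) = (if i = j then α else 0) - dx j * contract i α := by
  induction α using TensorProduct.induction_on with
  | zero => simp
  | add a b ha hb =>
    rw [mul_add, map_add, ha, hb, map_add, mul_add]
    split_ifs <;> abel
  | tmul p w =>
    rw [dx, Algebra.TensorProduct.tmul_mul_tmul, contract_tmul, contract_tmul,
      Algebra.TensorProduct.tmul_mul_tmul]
    erw [CliffordAlgebra.contractLeft_ι_mul]
    rw [TensorProduct.tmul_sub, one_mul]
    congr 1
    split_ifs with h
    · subst h; simp
    · simp [h]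

/-- Euler's identity in the exterior variables. -/
theorem sum_dx_mul_contract {k : ℕ} {α : Forms n} (hα : α ∈ formsDeg n k) :
    ∑ i, dx i * contract i α = (k : ℂ) • α := by
  refine formsDeg_induction (P := fun α => ∑ i, dx i * contract i α = (k : ℂ) • α) (by simp)
    (fun a b ha hb => ?_) (fun p w hw => ?_) hα
  · simp only [map_add, mul_add, Finset.sum_add_distrib, smul_add, ha, hb]
  · rw [← TensorProduct.tmul_smul, ← sum_ι_mul_contractLeft hw, TensorProduct.tmul_sum]
    refine Finset.sum_congr rfl fun i _ => ?_
    rw [dx, contract_tmul, Algebra.TensorProduct.tmul_mul_tmul, one_mul]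

/-- Forms of positive degree are combinations of the `dx_i`, by Euler's identity. -/
theorem exists_eq_sum_dx_mul {k : ℕ} {α : Forms n} (hα : α ∈ formsDeg n (k + 1)) :
    ∃ β : Fin n → Forms n, (∀ i, β i ∈ formsDeg n k) ∧ α = ∑ i, dx i * β i := by
  refine ⟨fun i => ((k + 1 : ℕ) : ℂ)⁻¹ • contract i α,
    fun i => Submodule.smul_mem _ _ (contract_mem i hα), ?_⟩
  have hk : ((k + 1 : ℕ) : ℂ) ≠ 0 := by exact_mod_cast k.succ_ne_zero
  simp only [mul_smul_comm, ← Finset.smul_sum]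
  rw [sum_dx_mul_contract hα, inv_smul_smul₀ hk]

variable (n) in
/-- The space `⨁ Ω²ⁱ⁺¹` of odd forms. -/
def oddForms : Submodule ℂ (Forms n) := ⨆ i : ℕ, formsDeg n (2 * i + 1)

theorem formsDeg_le_oddForms (k : ℕ) : formsDeg n (2 * k + 1) ≤ oddForms n :=
  le_iSup (fun k => formsDeg n (2 * k + 1)) k

theorem dx_mul_mem_oddForms (i : Fin n) {α : Forms n} (hα : α ∈ evenForms n) :
    dx i * α ∈ oddForms n := by
  refine evenForms_induction (P := fun α => dx i * α ∈ oddForms n) (by simp)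
    (fun a b ha hb => by rw [mul_add]; exact add_mem ha hb) (fun k α hα => ?_) hα
  have := formsDeg_mul (dx_mem i) hα
  rw [add_comm] at this
  exact formsDeg_le_oddForms _ this

theorem oddForms_induction {P : Forms n → Prop} (h0 : P 0)
    (hadd : ∀ a b, P a → P b → P (a + b)) (h : ∀ i, ∀ α ∈ evenForms n, P (dx i * α))
    {α : Forms n} (hα : α ∈ oddForms n) : P α := by
  refine Submodule.iSup_induction (motive := P) _ hα (fun k α hα => ?_) h0 hadd
  obtain ⟨β, hβ, rfl⟩ := exists_eq_sum_dx_mul hα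
  exact Finset.sum_induction _ P hadd h0 fun i _ =>
    h i _ (formsDeg_le_evenForms _ (hβ i))

theorem partialD_mem_evenForms (i : Fin n) {α : Forms n} (hα : α ∈ evenForms n) :
    partialD i α ∈ evenForms n :=
  evenForms_induction (P := fun α => partialD i α ∈ evenForms n) (by simp)
    (fun a b ha hb => by rw [map_add]; exact add_mem ha hb)
    (fun _ _ hα => formsDeg_le_evenForms _ (partialD_mem i hα)) hα

theorem dx_mul_dx_mem (i j : Fin n) : dx i * dx j ∈ evenForms n :=
  formsDeg_le_evenForms (n := n) 1
    (formsDeg_mul (k := 1) (l := 1) (dx_mem i) (dx_mem j))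

theorem d_mem_oddForms {α : Forms n} (hα : α ∈ evenForms n) : d α ∈ oddForms n := by
  rw [d_apply]
  exact sum_mem fun i _ => dx_mul_mem_oddForms i (partialD_mem_evenForms i hα)

theorem even_mul_dx {α : Forms n} (hα : α ∈ evenForms n) (i : Fin n) :
    α * dx i = dx i * α := evenForms_comm hα _

theorem evenForms_mul_odd {α β : Forms n} (hα : α ∈ evenForms n) (hβ : β ∈ oddForms n) :
    α * β ∈ oddForms n := by
  refine oddForms_induction (P := fun β => α * β ∈ oddForms n) (by simp)
    (fun a b ha hb => by rw [mul_add]; exact add_mem ha hb) (fun i β hβ => ?_) hβ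
  rw [← mul_assoc, even_mul_dx hα, mul_assoc]
  exact dx_mul_mem_oddForms i (evenForms_mul hα hβ)

theorem coord_mem (i : Fin n) : coord i ∈ evenForms n := mem_evenForms_of_poly _

theorem partialD_coord (i j : Fin n) : partialD i (coord j) = if i = j then 1 else 0 := by
  rw [coord, partialD_tmul, MvPolynomial.pderiv_X, Pi.single_apply]
  simp only [eq_comm (a := j)]
  split_ifs
  · rfl
  · simp

theorem d_coord (i : Fin n) : d (coord i) = dx i := by
  simp [d_apply, partialD_coord]

theorem coord_mul_tmul (i : Fin n) (p : MvPolynomial (Fin n) ℂ)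
    (w : ExteriorAlgebra ℂ (Fin n → ℂ)) :
    coord i * p ⊗ₜ[ℂ] w = (MvPolynomial.X i * p) ⊗ₜ w := by
  rw [coord, Algebra.TensorProduct.tmul_mul_tmul, one_mul]

/-- The even forms are generated, as an algebra under the wedge product, by the coordinates
`x_i` and the products `dx_i ∧ dx_j`. -/
theorem evenForms_generators_induction {P : Forms n → Prop}
    (hadd : ∀ a b, P a → P b → P (a + b)) (hsmul : ∀ (c : ℂ) a, P a → P (c • a)) (h1 : P 1)
    (hX : ∀ i, ∀ α ∈ evenForms n, P α → P (coord i * α))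
    (hdx : ∀ i j, ∀ α ∈ evenForms n, P α → P (dx i * dx j * α))
    {α : Forms n} (hα : α ∈ evenForms n) : P α := by
  have h0 : P 0 := by simpa using hsmul 0 1 h1
  have key : ∀ k, ∀ α ∈ formsDeg n (2 * k), P α := by
    intro k
    induction k with
    | zero =>
      intro α hα
      refine formsDeg_induction h0 hadd (fun p w hw => ?_) hα
      obtain ⟨r, rfl⟩ := Submodule.mem_one.1 (by simpa using hw)
      induction p using MvPolynomial.induction_on with
      | C a =>
        have : (MvPolynomial.C a : MvPolynomial (Fin n) ℂ) ⊗ₜ[ℂ] algebraMap ℂ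
            (ExteriorAlgebra ℂ (Fin n → ℂ)) r = (a * r) • (1 : Forms n) := by
          rw [Algebra.algebraMap_eq_smul_one, ← MvPolynomial.algebraMap_eq,
            Algebra.algebraMap_eq_smul_one, TensorProduct.smul_tmul_smul]
          rfl
        rw [this]
        exact hsmul _ _ h1
      | add p q hp hq => rw [TensorProduct.add_tmul]; exact hadd _ _ hp hq
      | mul_X p i hp =>
        rw [mul_comm, ← coord_mul_tmul]
        exact hX i _ (formsDeg_le_evenForms 0 (tmul_mem_formsDeg _ hw)) hp
    | succ k ih =>
      intro α hα
      obtain ⟨β, hβ, rfl⟩ := exists_eq_sum_dx_mul hα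
      refine Finset.sum_induction _ P hadd h0 fun i _ => ?_
      obtain ⟨γ, hγ, h⟩ := exists_eq_sum_dx_mul (hβ i)
      rw [h, Finset.mul_sum]
      refine Finset.sum_induction _ P hadd h0 fun j _ => ?_
      rw [← mul_assoc]
      exact hdx i j _ (formsDeg_le_evenForms _ (hγ j)) (ih _ (hγ j))
  exact evenForms_induction h0 hadd key hα

/-- The space of forms is spanned by the tensors of a homogeneous polynomial and a homogeneous
element of the exterior algebra. -/
theorem forms_induction {P : Forms n → Prop} (h0 : P 0)
    (hadd : ∀ a b, P a → P b → P (a + b))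
    (h : ∀ (a k : ℕ) (p : MvPolynomial (Fin n) ℂ) (w : ExteriorAlgebra ℂ (Fin n → ℂ)),
      p.IsHomogeneous a → w ∈ ⋀[ℂ]^k (Fin n → ℂ) → P (p ⊗ₜ w)) (α : Forms n) : P α := by
  induction α using TensorProduct.induction_on with
  | zero => exact h0
  | add a b ha hb => exact hadd a b ha hb
  | tmul p w =>
    induction p using MvPolynomial.induction_on' with
    | add p q hp hq => rw [TensorProduct.add_tmul]; exact hadd _ _ hp hq
    | monomial s c =>
      induction w using DirectSum.Decomposition.inductionOn
          (ℳ := fun k : ℕ => ⋀[ℂ]^k (Fin n → ℂ)) with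
      | zero => simpa using h0
      | homogeneous w => exact h _ _ _ _ (MvPolynomial.isHomogeneous_monomial c rfl) w.2
      | add v w hv hw => rw [TensorProduct.tmul_add]; exact hadd _ _ hv hw

/-- The linear endomorphism of the exterior algebra acting on `Λᵏ` as the scalar `c k`. -/
def extScale (c : ℕ → ℂ) :
    ExteriorAlgebra ℂ (Fin n → ℂ) →ₗ[ℂ] ExteriorAlgebra ℂ (Fin n → ℂ) :=
  DirectSum.toModule ℂ ℕ _ (fun k => c k • (⋀[ℂ]^k (Fin n → ℂ)).subtype) ∘ₗ
    (DirectSum.decomposeLinearEquiv (fun k : ℕ => ⋀[ℂ]^k (Fin n → ℂ))).toLinearMap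

theorem extScale_apply (c : ℕ → ℂ) {k : ℕ} {w : ExteriorAlgebra ℂ (Fin n → ℂ)}
    (hw : w ∈ ⋀[ℂ]^k (Fin n → ℂ)) : extScale c w = c k • w := by
  have := DirectSum.decompose_coe (fun k : ℕ => ⋀[ℂ]^k (Fin n → ℂ)) ⟨w, hw⟩
  simp only [extScale, LinearMap.comp_apply, LinearEquiv.coe_coe,
    DirectSum.decomposeLinearEquiv_apply]
  rw [this]
  erw [DirectSum.toModule_lof]
  simp

/-- The linear endomorphism of the space of forms acting as the scalar `c a k` on the forms of
degree `k` whose coefficients are homogeneous polynomials of degree `a`. -/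
def rescale (c : ℕ → ℕ → ℂ) : Forms n →ₗ[ℂ] Forms n :=
  TensorProduct.lift ((MvPolynomial.basisMonomials (Fin n) ℂ).constr ℂ fun s =>
    TensorProduct.mk ℂ _ _ (MvPolynomial.monomial s 1) ∘ₗ extScale (c s.degree))

theorem rescale_apply (c : ℕ → ℕ → ℂ) {a k : ℕ} {p : MvPolynomial (Fin n) ℂ}
    {w : ExteriorAlgebra ℂ (Fin n → ℂ)} (hp : p.IsHomogeneous a)
    (hw : w ∈ ⋀[ℂ]^k (Fin n → ℂ)) : rescale c (p ⊗ₜ w) = c a k • p ⊗ₜ[ℂ] w := by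
  have key : ∀ s : Fin n →₀ ℕ, rescale c (MvPolynomial.monomial s 1 ⊗ₜ w) =
      c s.degree k • MvPolynomial.monomial s 1 ⊗ₜ[ℂ] w := by
    intro s
    have hb : MvPolynomial.monomial s (1 : ℂ) = MvPolynomial.basisMonomials (Fin n) ℂ s := by simp
    rw [rescale, TensorProduct.lift.tmul, hb, Module.Basis.constr_basis, ← hb,
      LinearMap.comp_apply, extScale_apply _ hw, TensorProduct.mk_apply, TensorProduct.tmul_smul]
  rw [p.as_sum, TensorProduct.sum_tmul, map_sum, Finset.smul_sum]
  refine Finset.sum_congr rfl fun s hs => ?_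
  have hs' : s.degree = a := by
    by_contra h
    exact MvPolynomial.mem_support_iff.1 hs (hp.coeff_eq_zero h)
  rw [← mul_one (MvPolynomial.coeff s p), ← smul_eq_mul, ← MvPolynomial.smul_monomial,
    ← TensorProduct.smul_tmul', map_smul, key, hs', smul_comm]

end FormCalculus

/-! ### The Poincaré lemma -/

section Poincare

variable {n : ℕ}

theorem d_tmul (p : MvPolynomial (Fin n) ℂ) (w : ExteriorAlgebra ℂ (Fin n → ℂ)) :
    d (p ⊗ₜ[ℂ] w) = ∑ i, MvPolynomial.pderiv i p ⊗ₜ[ℂ]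
      (ExteriorAlgebra.ι ℂ (Pi.single i 1 : Fin n → ℂ) * w) := by
  rw [d_apply]
  refine Finset.sum_congr rfl fun i _ => ?_
  rw [partialD_tmul, dx, Algebra.TensorProduct.tmul_mul_tmul, one_mul]

theorem ι_mul_mem {k : ℕ} (v : Fin n → ℂ) {w : ExteriorAlgebra ℂ (Fin n → ℂ)}
    (hw : w ∈ ⋀[ℂ]^k (Fin n → ℂ)) : ExteriorAlgebra.ι ℂ v * w ∈ ⋀[ℂ]^(k + 1) (Fin n → ℂ) := by
  change _ ∈ LinearMap.range (ExteriorAlgebra.ι ℂ) ^ (k + 1)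
  rw [pow_succ']
  exact Submodule.mul_mem_mul ⟨v, rfl⟩ hw

/-- The differential lowers the degree of the coefficients and raises the degree of the form. -/
theorem rescale_d {c c' : ℕ → ℕ → ℂ} (h : ∀ a k, c' a (k + 1) = c (a + 1) k) (α : Forms n) :
    rescale c' (d α) = d (rescale c α) := by
  refine forms_induction (P := fun α => rescale c' (d α) = d (rescale c α)) (by simp)
    (fun a b ha hb => by simp only [map_add, ha, hb]) (fun a k p w hp hw => ?_) α
  rw [rescale_apply c hp hw, map_smul, d_tmul, map_sum, Finset.smul_sum]
  refine Finset.sum_congr rfl fun i _ => ?_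
  rw [rescale_apply c' hp.pderiv (ι_mul_mem _ hw)]
  cases a with
  | zero =>
    obtain ⟨r, rfl⟩ : ∃ r, p = MvPolynomial.C r :=
      ⟨_, MvPolynomial.totalDegree_eq_zero_iff_eq_C.1 (Nat.le_zero.1 hp.totalDegree_le)⟩
    simp
  | succ a => rw [Nat.add_sub_cancel, h]

theorem rescale_eq_smul {c : ℕ → ℕ → ℂ} {z : ℂ} {k : ℕ} (h : ∀ a, c a k = z) {α : Forms n}
    (hα : α ∈ formsDeg n k) : rescale c α = z • α := by
  refine formsDeg_induction (P := fun α => rescale c α = z • α) (by simp)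
    (fun a b ha hb => by rw [map_add, ha, hb, smul_add]) (fun p w hw => ?_) hα
  induction p using MvPolynomial.induction_on' with
  | add p q hp hq => rw [TensorProduct.add_tmul, map_add, hp, hq, smul_add]
  | monomial s b => rw [rescale_apply c (MvPolynomial.isHomogeneous_monomial b rfl) hw, h]

theorem rescale_mem (c : ℕ → ℕ → ℂ) {k : ℕ} {α : Forms n}
    (hα : α ∈ formsDeg n k) : rescale c α ∈ formsDeg n k := by
  refine formsDeg_induction (P := fun α => rescale c α ∈ formsDeg n k) (by simp)
    (fun a b ha hb => by rw [map_add]; exact add_mem ha hb) (fun p w hw => ?_) hα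
  induction p using MvPolynomial.induction_on' with
  | add p q hp hq => rw [TensorProduct.add_tmul, map_add]; exact add_mem hp hq
  | monomial s b =>
    rw [rescale_apply c (MvPolynomial.isHomogeneous_monomial b rfl) hw]
    exact Submodule.smul_mem _ _ (tmul_mem_formsDeg _ hw)

theorem rescale_mem_evenForms (c : ℕ → ℕ → ℂ) {α : Forms n}
    (hα : α ∈ evenForms n) : rescale c α ∈ evenForms n :=
  evenForms_induction (P := fun α => rescale c α ∈ evenForms n) (by simp)
    (fun a b ha hb => by rw [map_add]; exact add_mem ha hb)
    (fun _ _ hα => formsDeg_le_evenForms _ (rescale_mem c hα)) hα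

/-- An even form which is exact is the differential of an odd form. -/
theorem exists_odd_of_exact {α : Forms n} (h : d α ∈ evenForms n) :
    ∃ β ∈ oddForms n, d β = d α := by
  -- the odd component of `α`
  refine ⟨rescale (fun _ k => if Odd k then 1 else 0) α, ?_, ?_⟩
  · refine forms_induction
      (P := fun α => rescale (fun _ k => if Odd k then 1 else 0) α ∈ oddForms n) (by simp)
      (fun a b ha hb => by rw [map_add]; exact add_mem ha hb) (fun a k p w hp hw => ?_) α
    rw [rescale_apply _ hp hw]
    split_ifs with hk
    · obtain ⟨k, rfl⟩ := hk
      rw [one_smul]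
      exact formsDeg_le_oddForms k (tmul_mem_formsDeg p hw)
    · simp
  · rw [← rescale_d (c' := fun _ k => if Even k then 1 else 0)
      (fun a k => by simp [Nat.even_add_one])]
    refine evenForms_induction
      (P := fun α => rescale (fun _ k => if Even k then 1 else 0) α = α) (by simp)
      (fun a b ha hb => by rw [map_add, ha, hb]) (fun k α hα => ?_) h
    rw [rescale_eq_smul (z := 1) (fun a => by simp) hα, one_smul]

/-- The contraction of forms with the Euler vector field `∑ x_i ∂/∂x_i`. -/
def contractEuler : Forms n →ₗ[ℂ] Forms n :=
  ∑ i, LinearMap.mulLeft ℂ (coord i) ∘ₗ contract i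

theorem contractEuler_apply (α : Forms n) :
    contractEuler α = ∑ i, coord i * contract i α := by
  simp [contractEuler]

theorem contractEuler_mem_evenForms {α : Forms n} (hα : α ∈ oddForms n) :
    contractEuler α ∈ evenForms n := by
  rw [contractEuler_apply]
  refine sum_mem fun i _ => evenForms_mul (coord_mem i) ?_
  refine Submodule.iSup_induction (motive := fun α => contract i α ∈ evenForms n) _ hα
    (fun k α hα => formsDeg_le_evenForms k (contract_mem i hα)) (by simp)
    (fun a b ha hb => by rw [map_add]; exact add_mem ha hb)

theorem contract_partialD (i j : Fin n) (α : Forms n) :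
    contract i (partialD j α) = partialD j (contract i α) := by
  induction α using TensorProduct.induction_on with
  | zero => simp
  | add a b ha hb => simp only [map_add, ha, hb]
  | tmul p w => rfl

/-- Cartan's formula for the Lie derivative along the Euler vector field, which acts on forms of
degree `k` with homogeneous coefficients of degree `a` as the scalar `a + k`. -/
theorem d_contractEuler_add {a k : ℕ} {p : MvPolynomial (Fin n) ℂ}
    {w : ExteriorAlgebra ℂ (Fin n → ℂ)} (hp : p.IsHomogeneous a)
    (hw : w ∈ ⋀[ℂ]^k (Fin n → ℂ)) :
    d (contractEuler (p ⊗ₜ w)) + contractEuler (d (p ⊗ₜ w)) = ((a : ℂ) + k) • p ⊗ₜ[ℂ] w := by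
  set α : Forms n := p ⊗ₜ w with hα
  have h1 : d (contractEuler α) = ∑ i, dx i * contract i α +
      ∑ i, ∑ j, dx j * (coord i * partialD j (contract i α)) := by
    rw [contractEuler_apply, map_sum, ← Finset.sum_add_distrib]
    refine Finset.sum_congr rfl fun i _ => ?_
    rw [d_mul (coord_mem i), d_coord, d_apply, Finset.mul_sum]
    congr 1
    refine Finset.sum_congr rfl fun j _ => ?_
    rw [← mul_assoc, evenForms_comm (coord_mem i), mul_assoc]
  have h2 : contractEuler (d α) = ∑ i, coord i * partialD i α -
      ∑ i, ∑ j, dx j * (coord i * partialD j (contract i α)) := by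
    rw [contractEuler_apply, ← Finset.sum_sub_distrib]
    refine Finset.sum_congr rfl fun i _ => ?_
    rw [d_apply, map_sum]
    simp only [contract_dx_mul, Finset.sum_sub_distrib, contract_partialD, mul_sub,
      Finset.mul_sum, mul_ite, mul_zero]
    rw [Finset.sum_ite_eq Finset.univ i, if_pos (Finset.mem_univ i)]
    congr 1
    refine Finset.sum_congr rfl fun j _ => ?_
    rw [← mul_assoc, evenForms_comm (coord_mem i), mul_assoc]
  have h3 : ∑ i, coord i * partialD i α = (a : ℂ) • α := by
    simp only [hα, partialD_tmul, coord_mul_tmul]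
    rw [← TensorProduct.sum_tmul, hp.sum_X_mul_pderiv, ← Nat.cast_smul_eq_nsmul ℂ,
      TensorProduct.smul_tmul']
  rw [h1, h2, h3, sum_dx_mul_contract (tmul_mem_formsDeg p hw), add_smul]
  abel

/-- The Poincaré lemma for odd polynomial forms. -/
theorem exists_even_of_d_eq_zero {γ : Forms n} (hγ : γ ∈ oddForms n) (h : d γ = 0) :
    ∃ δ ∈ evenForms n, d δ = γ := by
  -- the inverse of the Lie derivative along the Euler vector field; it commutes with `d`
  let c : ℕ → ℕ → ℂ := fun a k => ((a : ℂ) + k)⁻¹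
  have key : rescale c (d (contractEuler γ) + contractEuler (d γ)) = γ := by
    have hdeg : ∀ k, ∀ α ∈ formsDeg n (2 * k + 1),
        rescale c (d (contractEuler α) + contractEuler (d α)) = α := by
      intro k α hα
      refine formsDeg_induction
        (P := fun α => rescale c (d (contractEuler α) + contractEuler (d α)) = α) (by simp)
        (fun a b ha hb => ?_) (fun p w hw => ?_) hα
      · conv_rhs => rw [← ha, ← hb]
        simp only [map_add]; abel
      · induction p using MvPolynomial.induction_on' with
        | add p q hp hq =>
          conv_rhs => rw [TensorProduct.add_tmul, ← hp, ← hq]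
          simp only [TensorProduct.add_tmul, map_add]; abel
        | monomial s b =>
          have hs : (MvPolynomial.monomial s b).IsHomogeneous s.degree :=
            MvPolynomial.isHomogeneous_monomial b rfl
          rw [d_contractEuler_add hs hw, map_smul, rescale_apply c hs hw, smul_inv_smul₀]
          have h0 : ((s.degree + (2 * k + 1) : ℕ) : ℂ) ≠ 0 := Nat.cast_ne_zero.2 (by omega)
          exact_mod_cast h0
    exact Submodule.iSup_induction (motive := fun α =>
      rescale c (d (contractEuler α) + contractEuler (d α)) = α) _ hγ hdeg (by simp)
      (fun a b ha hb => by
        conv_rhs => rw [← ha, ← hb]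
        simp only [map_add]; abel)
  refine ⟨rescale c (contractEuler γ),
    rescale_mem_evenForms c (contractEuler_mem_evenForms hγ), ?_⟩
  rw [← rescale_d (c' := c) (fun a k => by simp only [c]; push_cast; ring_nf)]
  simpa [h] using key

end Poincare

/-! ### Algebras with central commutators -/

section Jordan

variable {Q : Type*} [Ring Q] [Algebra ℂ Q]

/-- The space `Q`, to be endowed with the Jordan product `½(ab + ba)`. The hypothesis, that
commutators are central, makes this product associative. -/
def Jordan (_ : ∀ a b c : Q, Commute a (b * c - c * b)) : Type _ := Q

variable (h : ∀ a b c : Q, Commute a (b * c - c * b))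

instance : AddCommGroup (Jordan h) := inferInstanceAs (AddCommGroup Q)

instance : Module ℂ (Jordan h) := inferInstanceAs (Module ℂ Q)

/-- The identity map from `Q` with the Jordan product to `Q`. -/
def ofJordan : Jordan h →ₗ[ℂ] Q := LinearMap.id

instance : Mul (Jordan h) where
  mul a b := ((1 / 2 : ℂ) • (ofJordan h a * ofJordan h b + ofJordan h b * ofJordan h a) : Q)

instance : One (Jordan h) := ⟨(1 : Q)⟩

theorem ofJordan_injective : Function.Injective (ofJordan h) := Function.injective_id

theorem ofJordan_mul (a b : Jordan h) : ofJordan h (a * b) =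
    (1 / 2 : ℂ) • (ofJordan h a * ofJordan h b + ofJordan h b * ofJordan h a) := rfl

theorem ofJordan_one : ofJordan h 1 = 1 := rfl

theorem half_smul_add_self {V : Type*} [AddCommGroup V] [Module ℂ V] (v : V) :
    (1 / 2 : ℂ) • (v + v) = v := by
  rw [← two_smul ℂ v, smul_smul]; norm_num

theorem jordan_assoc (a b c : Jordan h) : a * b * c = a * (b * c) := by
  apply ofJordan_injective
  simp only [ofJordan_mul, smul_mul_assoc, mul_smul_comm, ← smul_add]
  congr 2
  have := (h (ofJordan h b) (ofJordan h a) (ofJordan h c)).eq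
  rw [← sub_eq_zero] at this ⊢
  rw [← this]
  noncomm_ring

theorem jordan_comm (a b : Jordan h) : a * b = b * a :=
  ofJordan_injective h (by rw [ofJordan_mul, ofJordan_mul, add_comm])

theorem jordan_left_distrib (a b c : Jordan h) : a * (b + c) = a * b + a * c :=
  ofJordan_injective h (by
    simp only [ofJordan_mul, map_add, mul_add, add_mul, smul_add]; abel)

theorem jordan_one_mul (a : Jordan h) : 1 * a = a :=
  ofJordan_injective h (by
    rw [ofJordan_mul, ofJordan_one, one_mul, mul_one, half_smul_add_self])

instance : CommRing (Jordan h) where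
  __ := (inferInstance : AddCommGroup (Jordan h))
  mul_assoc := jordan_assoc h
  mul_comm := jordan_comm h
  one_mul := jordan_one_mul h
  mul_one a := by rw [jordan_comm, jordan_one_mul]
  zero_mul a := ofJordan_injective h (by simp [ofJordan_mul])
  mul_zero a := ofJordan_injective h (by simp [ofJordan_mul])
  left_distrib := jordan_left_distrib h
  right_distrib a b c := by
    rw [jordan_comm, jordan_left_distrib, jordan_comm h c a, jordan_comm h c b]

instance : Algebra ℂ (Jordan h) :=
  Algebra.ofModule
    (fun r a b => ofJordan_injective h (by
      simp only [ofJordan_mul, map_smul, smul_mul_assoc, mul_smul_comm, smul_add, smul_comm r]))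
    (fun r a b => ofJordan_injective h (by
      simp only [ofJordan_mul, map_smul, smul_mul_assoc, mul_smul_comm, smul_add, smul_comm r]))

variable {n : ℕ} (y : Fin n → Q)

/-- The evaluation of polynomials at `y₁, …, yₙ ∈ Q` with respect to the Jordan product. -/
def jordanEval : MvPolynomial (Fin n) ℂ →ₗ[ℂ] Q :=
  ofJordan h ∘ₗ (MvPolynomial.aeval (S₁ := Jordan h) y).toLinearMap

theorem jordanEval_one : jordanEval h y 1 = 1 := by
  simp [jordanEval, ofJordan_one]

theorem jordanEval_mul_X (p : MvPolynomial (Fin n) ℂ) (i : Fin n) :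
    jordanEval h y (p * MvPolynomial.X i) =
      (1 / 2 : ℂ) • (jordanEval h y p * y i + y i * jordanEval h y p) := by
  simp only [jordanEval, LinearMap.comp_apply, AlgHom.toLinearMap_apply, map_mul,
    ofJordan_mul]
  erw [MvPolynomial.aeval_X]

include h in
/-- The relation that makes products of commutators alternating. -/
theorem commutator_mul_commutator_eq_zero (a b c : Q) :
    (a * b - b * a) * (b * c - c * b) = 0 := by
  set u := a * b - b * a with hu
  have hc : ∀ z, z * u = u * z := fun z => (h z a b).eq
  -- `[a, b²] = 2 b [a, b]` commutes with `c`
  have h1 := (h c a (b * b)).eq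
  have h2 : a * (b * b) - b * b * a = u * b + b * u := by rw [hu]; noncomm_ring
  rw [h2, hc b, mul_add, add_mul, ← mul_assoc, hc c, ← two_mul, ← two_mul] at h1
  have h3 : (2 : ℂ) • (u * (b * c - c * b)) = 0 := by
    rw [two_smul, ← two_mul, mul_sub, mul_sub, sub_eq_zero]
    simpa only [mul_assoc] using h1.symm
  exact (smul_eq_zero.1 h3).resolve_left two_ne_zero

/-- In an algebra with central commutators, `[y_i, ·]` is a derivation of the Jordan product. -/
theorem commutator_jordanEval (p : MvPolynomial (Fin n) ℂ) (i : Fin n) :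
    y i * jordanEval h y p - jordanEval h y p * y i =
      ∑ j, jordanEval h y (MvPolynomial.pderiv j p) * (y i * y j - y j * y i) := by
  induction p using MvPolynomial.induction_on with
  | C a =>
    have : jordanEval h y (MvPolynomial.C a) = a • 1 := by
      rw [← jordanEval_one h y, ← map_smul, MvPolynomial.smul_eq_C_mul, mul_one]
    simp [this]
  | add p q hp hq =>
    simp only [map_add, add_mul, Finset.sum_add_distrib, ← hp, ← hq]
    noncomm_ring
  | mul_X p k hp =>
    have h1 : ∀ j, jordanEval h y (MvPolynomial.pderiv j (p * MvPolynomial.X k)) *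
        (y i * y j - y j * y i) =
        (1 / 2 : ℂ) • (jordanEval h y (MvPolynomial.pderiv j p) * (y i * y j - y j * y i) * y k +
          y k * (jordanEval h y (MvPolynomial.pderiv j p) * (y i * y j - y j * y i))) +
        if j = k then jordanEval h y p * (y i * y k - y k * y i) else 0 := by
      intro j
      have hc := (h (y k) (y i) (y j)).eq
      rw [Derivation.leibniz, smul_eq_mul, smul_eq_mul, mul_comm (MvPolynomial.X k), map_add,
        jordanEval_mul_X, add_mul, add_comm, smul_mul_assoc, add_mul,
        mul_assoc _ (y i * y j - y j * y i) (y k), ← hc, mul_assoc, mul_assoc]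
      congr 1
      rw [MvPolynomial.pderiv_X, Pi.single_apply]
      by_cases hjk : j = k
      · subst hjk; simp
      · simp [hjk, Ne.symm hjk]
    rw [Finset.sum_congr rfl fun j _ => h1 j, Finset.sum_add_distrib, ← Finset.smul_sum,
      Finset.sum_add_distrib, ← Finset.sum_mul, ← Finset.mul_sum, ← hp, Finset.sum_ite_eq',
      if_pos (Finset.mem_univ k), jordanEval_mul_X]
    set P := jordanEval h y p
    have hc := (h P (y i) (y k)).eq
    have h2 : P * (y i * y k - y k * y i) = (1 / 2 : ℂ) •
        (P * (y i * y k - y k * y i) + (y i * y k - y k * y i) * P) := by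
      rw [← hc, half_smul_add_self]
    rw [h2, ← smul_add, mul_smul_comm, smul_mul_assoc, ← smul_sub]
    congr 1
    noncomm_ring

theorem exteriorPower_le_evenOdd (k : ℕ) : ⋀[ℂ]^(2 * k) (Fin n → ℂ) ≤
    CliffordAlgebra.evenOdd (0 : QuadraticForm ℂ (Fin n → ℂ)) 0 :=
  le_iSup (fun j : {m : ℕ // (m : ZMod 2) = 0} =>
    LinearMap.range (CliffordAlgebra.ι (0 : QuadraticForm ℂ (Fin n → ℂ))) ^ (j : ℕ))
    ⟨2 * k, by push_cast; rw [show (2 : ZMod 2) = 0 from rfl, zero_mul]⟩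

include h in
/-- The universal property of the even part of the exterior algebra provides the homomorphism
`e_i ∧ e_j ↦ [y_i, y_j]`; it is extended to the odd part as an arbitrary linear map. -/
theorem exists_even_exterior_lift : ∃ E : ExteriorAlgebra ℂ (Fin n → ℂ) →ₗ[ℂ] Q, E 1 = 1 ∧
    ∀ i j, ∀ w ∈ CliffordAlgebra.evenOdd (0 : QuadraticForm ℂ (Fin n → ℂ)) 0,
      E (ExteriorAlgebra.ι ℂ (Pi.single i 1) * (ExteriorAlgebra.ι ℂ (Pi.single j 1) * w)) =
        (y i * y j - y j * y i) * E w := by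
  let Y : (Fin n → ℂ) →ₗ[ℂ] Q := Fintype.linearCombination ℂ y
  have hY : ∀ i, Y (Pi.single i 1) = y i := by
    intro i
    simp [Y, Fintype.linearCombination_apply_single]
  let f : CliffordAlgebra.EvenHom (0 : QuadraticForm ℂ (Fin n → ℂ)) Q :=
    { bilin := ((LinearMap.mul ℂ Q) - (LinearMap.mul ℂ Q).flip).compl₁₂ Y Y
      contract := fun m => by simp
      contract_mid := fun a b c => by
        simpa using commutator_mul_commutator_eq_zero h (Y a) (Y b) (Y c) }
  obtain ⟨E, hE⟩ := LinearMap.exists_extend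
    (p := CliffordAlgebra.evenOdd (0 : QuadraticForm ℂ (Fin n → ℂ)) 0)
    (CliffordAlgebra.even.lift _ f).toLinearMap
  have hE' : ∀ w : CliffordAlgebra.even (0 : QuadraticForm ℂ (Fin n → ℂ)),
      E w = CliffordAlgebra.even.lift _ f w := fun w => LinearMap.congr_fun hE w
  refine ⟨E, ?_, fun i j w hw => ?_⟩
  · exact (hE' 1).trans (map_one _)
  · rw [← mul_assoc]
    have h1 := hE' ((CliffordAlgebra.even.ι _).bilin (Pi.single i 1) (Pi.single j 1) * ⟨w, hw⟩)
    rw [map_mul, CliffordAlgebra.even.lift_ι, ← hE'] at h1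
    refine h1.trans ?_
    simp [f, hY]

include h in
/-- The inverse of `φ`: if commutators of `Q` are central, the homomorphism `x_i ↦ y_i` to `Q`
from the free algebra factors linearly through `φ̃`. -/
theorem exists_linear_factorization : ∃ Ψ : Forms n →ₗ[ℂ] Q,
    ∀ a : FreeAlg n, Ψ (toForm n (phiTilde n a)) = FreeAlgebra.lift ℂ y a := by
  obtain ⟨E, hE1, hE⟩ := exists_even_exterior_lift h y
  let P := jordanEval h y
  let Ψ : Forms n →ₗ[ℂ] Q := LinearMap.mul' ℂ Q ∘ₗ TensorProduct.map P E
  have hΨ : ∀ p w, Ψ (p ⊗ₜ w) = P p * E w := fun p w => by simp [Ψ]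
  -- `Ψ (x_i ∗ α) = y_i * Ψ α`: the two terms of `x_i ∗ α` give half of the anticommutator and half
  -- of the commutator with `y_i`
  have hx : ∀ i, ∀ α ∈ evenForms n,
      Ψ (coord i * α + (1 / 2 : ℂ) • (dx i * d α)) = y i * Ψ α := by
    intro i α hα
    have hadd : ∀ a b : Forms n, coord i * (a + b) + (1 / 2 : ℂ) • (dx i * d (a + b)) =
        (coord i * a + (1 / 2 : ℂ) • (dx i * d a)) +
          (coord i * b + (1 / 2 : ℂ) • (dx i * d b)) := by
      intro a b
      simp only [map_add, mul_add, smul_add]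
      abel
    refine evenForms_induction
      (P := fun α => Ψ (coord i * α + (1 / 2 : ℂ) • (dx i * d α)) = y i * Ψ α) (by simp)
      (fun a b ha hb => ?_) (fun k α hα => ?_) hα
    · rw [hadd, map_add, ha, hb, map_add, mul_add]
    refine formsDeg_induction
      (P := fun α => Ψ (coord i * α + (1 / 2 : ℂ) • (dx i * d α)) = y i * Ψ α) (by simp)
      (fun a b ha hb => ?_) (fun p w hw => ?_) hα
    · rw [hadd, map_add, ha, hb, map_add, mul_add]
    have h1 : Ψ (dx i * d (p ⊗ₜ w)) = (y i * P p - P p * y i) * E w := by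
      rw [d_tmul, Finset.mul_sum, map_sum, commutator_jordanEval h y, Finset.sum_mul]
      refine Finset.sum_congr rfl fun j _ => ?_
      rw [dx, Algebra.TensorProduct.tmul_mul_tmul, one_mul, hΨ,
        hE i j w (exteriorPower_le_evenOdd k hw), mul_assoc]
    rw [map_add, map_smul, h1, coord_mul_tmul, hΨ, hΨ, mul_comm, ← smul_mul_assoc, ← add_mul,
      ← mul_assoc]
    congr 1
    rw [jordanEval_mul_X, ← smul_add]
    have : ∀ a b : Q, a + b + (b - a) = b + b := fun a b => by abel
    rw [this, half_smul_add_self]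
  have hmul : ∀ (a : FreeAlg n) (β : EvenStar n),
      Ψ (toForm n (phiTilde n a * β)) = FreeAlgebra.lift ℂ y a * Ψ (toForm n β) := by
    intro a
    induction a using FreeAlgebra.induction with
    | grade0 r => intro β; simp [Algebra.algebraMap_eq_smul_one]
    | grade1 i =>
      intro β
      rw [FreeAlgebra.lift_ι_apply, ← hx i _ (toForm_mem β), phiTilde, FreeAlgebra.lift_ι_apply,
        toForm_mul, show toForm n (x i) = coord i from rfl, d_coord]
    | mul a b ha hb => 
      intro β
      rw [map_mul (phiTilde n), mul_assoc (phiTilde n a), ha, hb, map_mul, mul_assoc]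
    | add a b ha hb => intro β; rw [map_add, add_mul, map_add, map_add, ha, hb, map_add, add_mul]
  refine ⟨Ψ, fun a => ?_⟩
  have h1 : Ψ (toForm n 1) = 1 := by
    rw [toForm_one, Algebra.TensorProduct.one_def, hΨ, hE1, mul_one]
    exact jordanEval_one h y
  simpa [h1] using hmul a 1

end Jordan

/-! ### The isomorphism `A / M₃ ≅ Ω_∗^even` -/

section Isomorphism

variable {n : ℕ}

theorem odd_anticomm {α β : Forms n} (hα : α ∈ oddForms n) (hβ : β ∈ oddForms n) :
    α * β = -(β * α) := by
  refine oddForms_induction (P := fun α => α * β = -(β * α)) (by simp)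
    (fun a b ha hb => by rw [add_mul, ha, hb, mul_add, neg_add]) (fun i α hα => ?_) hα
  refine oddForms_induction (P := fun β => dx i * α * β = -(β * (dx i * α))) (by simp)
    (fun a b ha hb => by rw [mul_add, ha, hb, add_mul, neg_add]) (fun j β hβ => ?_) hβ
  have h : ∀ (i j : Fin n) (α β : Forms n), α ∈ evenForms n →
      dx i * α * (dx j * β) = dx i * dx j * (α * β) := by
    intro i j α β hα
    rw [mul_assoc, ← mul_assoc α, even_mul_dx hα, mul_assoc (dx j), mul_assoc]
  rw [h i j α β hα, h j i β α hβ, dx_mul_dx, evenForms_comm hα]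
  exact neg_mul (dx j * dx i) _

theorem toForm_commutator (α β : EvenStar n) :
    toForm n (α * β - β * α) = d (toForm n α) * d (toForm n β) := by
  rw [map_sub, toForm_mul, toForm_mul, evenForms_comm (toForm_mem β),
    odd_anticomm (d_mem_oddForms (toForm_mem β)) (d_mem_oddForms (toForm_mem α)), smul_neg,
    add_sub_add_left_eq_sub, sub_neg_eq_add, ← smul_add, half_smul_add_self]

variable (n) in
/-- The homomorphism `φ̃`, viewed as a linear map to the space of all forms. -/
def formOf : FreeAlg n →ₗ[ℂ] Forms n := toForm n ∘ₗ (phiTilde n).toLinearMap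

theorem formOf_apply (a : FreeAlg n) : formOf n a = toForm n (phiTilde n a) := rfl

theorem formOf_mem (a : FreeAlg n) : formOf n a ∈ evenForms n := toForm_mem _

theorem formOf_mul (a b : FreeAlg n) : formOf n (a * b) =
    formOf n a * formOf n b + (1 / 2 : ℂ) • (d (formOf n a) * d (formOf n b)) := by
  simp only [formOf_apply, map_mul, toForm_mul]

theorem formOf_commutator (a b : FreeAlg n) :
    formOf n (a * b - b * a) = d (formOf n a) * d (formOf n b) := by
  simp only [formOf_apply, map_sub (phiTilde n), map_mul, toForm_commutator]

theorem formOf_mul_commutator (a b c : FreeAlg n) :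
    formOf n (a * (b * c - c * b)) = formOf n a * (d (formOf n b) * d (formOf n c)) := by
  rw [formOf_mul, formOf_commutator, d_d_mul_d (formOf_mem b), mul_zero, smul_zero, add_zero]

theorem formOf_one : formOf n 1 = 1 := by
  rw [formOf_apply, map_one, toForm_one]

theorem formOf_ι (i : Fin n) : formOf n (FreeAlgebra.ι ℂ i) = coord i := by
  rw [formOf_apply, phiTilde, FreeAlgebra.lift_ι_apply]; rfl

/-- The products `x_i ∧ α` and `dx_i ∧ dx_j ∧ α` are a Jordan product and a product with a
commutator, so that `φ̃` is onto. -/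
theorem exists_formOf_eq {α : Forms n} (hα : α ∈ evenForms n) : ∃ a, formOf n a = α := by
  refine evenForms_generators_induction (P := fun α => ∃ a, formOf n a = α) ?_ ?_
    ⟨1, formOf_one⟩ ?_ ?_ hα
  · rintro _ _ ⟨a, rfl⟩ ⟨b, rfl⟩
    exact ⟨a + b, map_add _ _ _⟩
  · rintro c _ ⟨a, rfl⟩
    exact ⟨c • a, map_smul _ _ _⟩
  · rintro i _ - ⟨a, rfl⟩
    refine ⟨(1 / 2 : ℂ) • (FreeAlgebra.ι ℂ i * a + a * FreeAlgebra.ι ℂ i), ?_⟩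
    rw [map_smul, map_add, formOf_mul, formOf_mul, evenForms_comm (formOf_mem a), formOf_ι,
      odd_anticomm (d_mem_oddForms (formOf_mem a)) (d_mem_oddForms (coord_mem i)), smul_neg,
      add_add_add_comm, add_neg_cancel, add_zero, half_smul_add_self]
  · rintro i j _ - ⟨a, rfl⟩
    refine ⟨a * (FreeAlgebra.ι ℂ i * FreeAlgebra.ι ℂ j - FreeAlgebra.ι ℂ j * FreeAlgebra.ι ℂ i),
      ?_⟩
    rw [formOf_mul_commutator, formOf_ι, formOf_ι, d_coord, d_coord,
      evenForms_comm (formOf_mem a)]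

theorem phiTilde_surjective : Function.Surjective (phiTilde n) := fun α => by
  obtain ⟨a, ha⟩ := exists_formOf_eq (toForm_mem α)
  exact ⟨a, toForm_injective ha⟩

theorem commute_commutator_quotient (a b c : FreeAlg n ⧸ M ℂ (FreeAlg n) 3) :
    Commute a (b * c - c * b) := by
  obtain ⟨a, rfl⟩ := Ideal.Quotient.mk_surjective a
  obtain ⟨b, rfl⟩ := Ideal.Quotient.mk_surjective b
  obtain ⟨c, rfl⟩ := Ideal.Quotient.mk_surjective c
  have := L_le_M ℂ (FreeAlg n) 3 (commutator_mem_L_three a (commutator_mem_L_two b c))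
  rw [← Ideal.Quotient.eq_zero_iff_mem, map_sub, sub_eq_zero] at this
  simpa only [map_mul, map_sub, Commute, SemiconjBy] using this

theorem formOf_eq_zero_iff {a : FreeAlg n} : formOf n a = 0 ↔ a ∈ M ℂ (FreeAlg n) 3 := by
  constructor
  · intro ha
    obtain ⟨Ψ, hΨ⟩ := exists_linear_factorization (Q := FreeAlg n ⧸ M ℂ (FreeAlg n) 3)
      commute_commutator_quotient fun i => Ideal.Quotient.mk _ (FreeAlgebra.ι ℂ i)
    have h1 : FreeAlgebra.lift ℂ (fun i => Ideal.Quotient.mk (M ℂ (FreeAlg n) 3)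
        (FreeAlgebra.ι ℂ i)) = Ideal.Quotient.mkₐ ℂ (M ℂ (FreeAlg n) 3) := by
      ext i
      simp
    have h2 := hΨ a
    rw [h1, ← formOf_apply, ha, map_zero] at h2
    exact Ideal.Quotient.eq_zero_iff_mem.1 h2.symm
  · intro ha
    rw [formOf_apply, phiTilde_eq_zero ha, map_zero]

theorem phi_mk (a : FreeAlg n) : phi n (Ideal.Quotient.mk _ a) = phiTilde n a := rfl

theorem phi_bijective : Function.Bijective (phi n) := by
  constructor
  · rw [injective_iff_map_eq_zero]
    intro q hq
    obtain ⟨a, rfl⟩ := Ideal.Quotient.mk_surjective q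
    rw [phi_mk] at hq
    rw [Ideal.Quotient.eq_zero_iff_mem, ← formOf_eq_zero_iff, formOf_apply, hq, map_zero]
  · intro α
    obtain ⟨a, rfl⟩ := phiTilde_surjective α
    exact ⟨Ideal.Quotient.mk _ a, rfl⟩

/-- Images under `φ` of subspaces of `A / M₃` are images under `φ̃`. -/
theorem map_phi_map_mk (S : Submodule ℂ (FreeAlg n)) :
    (S.map (Ideal.Quotient.mkₐ ℂ (M ℂ (FreeAlg n) 3)).toLinearMap).map (phi n).toLinearMap =
      S.map (phiTilde n).toLinearMap := by
  rw [← Submodule.map_comp]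
  rfl

end Isomorphism

/-! ### The images of `M₂` and `L₂` -/

section Images

variable {n : ℕ}

theorem formsDeg_le_evenPosForms (k : ℕ) : formsDeg n (2 * (k + 1)) ≤ evenPosForms n :=
  le_iSup (fun k => formsDeg n (2 * (k + 1))) k

theorem evenPosForms_mul {α β : Forms n} (hα : α ∈ evenPosForms n) (hβ : β ∈ evenForms n) :
    α * β ∈ evenPosForms n := by
  refine Submodule.iSup_induction (motive := fun α => α * β ∈ evenPosForms n) _ hα
    (fun k α hα => ?_) (by simp) (fun a b ha hb => by rw [add_mul]; exact add_mem ha hb)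
  refine evenForms_induction (P := fun β => α * β ∈ evenPosForms n) (by simp)
    (fun a b ha hb => by rw [mul_add]; exact add_mem ha hb) (fun l β hβ => ?_) hβ
  have := formsDeg_mul hα hβ
  rw [show 2 * (k + 1) + 2 * l = 2 * (k + l + 1) by ring] at this
  exact formsDeg_le_evenPosForms _ this

theorem d_mul_d_mem_evenPosForms {α β : Forms n} (hα : α ∈ evenForms n)
    (hβ : β ∈ evenForms n) : d α * d β ∈ evenPosForms n := by
  refine evenForms_induction (P := fun α => d α * d β ∈ evenPosForms n) (by simp)
    (fun a b ha hb => by rw [map_add, add_mul]; exact add_mem ha hb) (fun k α hα => ?_) hα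
  refine evenForms_induction (P := fun β => d α * d β ∈ evenPosForms n) (by simp)
    (fun a b ha hb => by rw [map_add, mul_add]; exact add_mem ha hb) (fun l β hβ => ?_) hβ
  have := formsDeg_mul (d_mem hα) (d_mem hβ)
  rw [show 2 * k + 1 + (2 * l + 1) = 2 * (k + l + 1) by ring] at this
  exact formsDeg_le_evenPosForms _ this

/-- `φ̃(M₂)` is the ideal generated by the forms `dx_i ∧ dx_j`. -/
theorem map_M_two : ((M ℂ (FreeAlg n) 2).restrictScalars ℂ).map (phiTilde n).toLinearMap =
    evenPos n := by
  apply le_antisymm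
  · rintro _ ⟨a, ha, rfl⟩
    change formOf n a ∈ evenPosForms n
    have ha' : a ∈ TwoSidedIdeal.span (L ℂ (FreeAlg n) 2 : Set (FreeAlg n)) :=
      TwoSidedIdeal.mem_asIdeal.1 ha
    clear ha
    induction ha' using TwoSidedIdeal.span_induction with
    | mem l hl =>
      rw [SetLike.mem_coe, L_succ ℂ _ le_rfl] at hl
      induction hl using Submodule.span_induction with
      | mem c hc =>
        obtain ⟨a, b, -, rfl⟩ := hc
        rw [formOf_commutator]
        exact d_mul_d_mem_evenPosForms (formOf_mem a) (formOf_mem b)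
      | zero => simp
      | add b c _ _ hb hc => rw [map_add]; exact add_mem hb hc
      | smul r b _ hb => rw [map_smul]; exact Submodule.smul_mem _ _ hb
    | zero => simp
    | add b c _ _ hb hc => rw [map_add]; exact add_mem hb hc
    | neg b _ hb => rw [map_neg]; exact neg_mem hb
    | left_absorb b x _ hx =>
      rw [formOf_mul, evenForms_comm (formOf_mem b)]
      exact add_mem (evenPosForms_mul hx (formOf_mem b))
        (Submodule.smul_mem _ _ (d_mul_d_mem_evenPosForms (formOf_mem b) (formOf_mem x)))
    | right_absorb b x _ hx =>
      rw [formOf_mul]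
      exact add_mem (evenPosForms_mul hx (formOf_mem b))
        (Submodule.smul_mem _ _ (d_mul_d_mem_evenPosForms (formOf_mem x) (formOf_mem b)))
  · intro α hα
    suffices h : ∃ a ∈ M ℂ (FreeAlg n) 2, formOf n a = toForm n α by
      obtain ⟨a, ha, h⟩ := h
      exact ⟨a, ha, toForm_injective h⟩
    have h0 : ∃ a ∈ M ℂ (FreeAlg n) 2, formOf n a = 0 := ⟨0, zero_mem _, map_zero _⟩
    have hadd : ∀ β γ : Forms n, (∃ a ∈ M ℂ (FreeAlg n) 2, formOf n a = β) →
        (∃ a ∈ M ℂ (FreeAlg n) 2, formOf n a = γ) →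
        ∃ a ∈ M ℂ (FreeAlg n) 2, formOf n a = β + γ := by
      rintro _ _ ⟨a, ha, rfl⟩ ⟨b, hb, rfl⟩
      exact ⟨a + b, add_mem ha hb, map_add _ _ _⟩
    refine Submodule.iSup_induction
      (motive := fun α => ∃ a ∈ M ℂ (FreeAlg n) 2, formOf n a = α) _
      (show toForm n α ∈ evenPosForms n from hα) (fun k α hα => ?_) h0 hadd
    obtain ⟨β, hβ, rfl⟩ := exists_eq_sum_dx_mul (k := 2 * k + 1) hα
    refine Finset.sum_induction _ (fun α => ∃ a ∈ M ℂ (FreeAlg n) 2, formOf n a = α) hadd h0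
      fun i _ => ?_
    obtain ⟨γ, hγ, h⟩ := exists_eq_sum_dx_mul (hβ i)
    rw [h, Finset.mul_sum]
    refine Finset.sum_induction _ (fun α => ∃ a ∈ M ℂ (FreeAlg n) 2, formOf n a = α) hadd h0
      fun j _ => ?_
    obtain ⟨a, ha⟩ := exists_formOf_eq (formsDeg_le_evenForms _ (hγ j))
    refine ⟨a * (FreeAlgebra.ι ℂ i * FreeAlgebra.ι ℂ j - FreeAlgebra.ι ℂ j * FreeAlgebra.ι ℂ i),
      Ideal.mul_mem_left _ _ (L_le_M ℂ _ 2 (commutator_mem_L_two _ _)), ?_⟩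
    rw [formOf_mul_commutator, formOf_ι, formOf_ι, d_coord, d_coord,
      evenForms_comm (formOf_mem a), ha, mul_assoc]

theorem d_dx_mul (i : Fin n) {α : Forms n} (hα : α ∈ evenForms n) :
    d (dx i * α) = d α * dx i := by
  rw [← even_mul_dx hα, d_mul hα, ← d_coord, d_d, mul_zero, add_zero]

/-- `φ̃(L₂)` is spanned by the forms `dα ∧ dβ = d(α ∧ dβ)`. Conversely, a form that is exact and
even is the differential of a sum of forms `dx_i ∧ α` with `α` even. -/
theorem map_L_two : (L ℂ (FreeAlg n) 2).map (phiTilde n).toLinearMap = evenExact n := by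
  apply le_antisymm
  · rintro _ ⟨l, hl, rfl⟩
    change formOf n l ∈ LinearMap.range (d (n := n))
    rw [SetLike.mem_coe, L_succ ℂ _ le_rfl] at hl
    induction hl using Submodule.span_induction with
    | mem c hc =>
      obtain ⟨a, b, -, rfl⟩ := hc
      refine ⟨formOf n a * d (formOf n b), ?_⟩
      rw [formOf_commutator, d_mul (formOf_mem a), d_d, mul_zero, add_zero]
    | zero => simp
    | add b c _ _ hb hc => rw [map_add]; exact add_mem hb hc
    | smul r b _ hb => rw [map_smul]; exact Submodule.smul_mem _ _ hb
  · rintro ω ⟨α, hα⟩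
    obtain ⟨β, hβ, h⟩ := exists_odd_of_exact (α := α) (hα ▸ toForm_mem ω)
    have key : ∃ l ∈ L ℂ (FreeAlg n) 2, formOf n l = d β := by
      refine oddForms_induction (P := fun β => ∃ l ∈ L ℂ (FreeAlg n) 2, formOf n l = d β)
        ⟨0, zero_mem _, by simp⟩ ?_ (fun i γ hγ => ?_) hβ
      · rintro a b ⟨l, hl, h⟩ ⟨m, hm, h'⟩
        exact ⟨l + m, add_mem hl hm, by rw [map_add, map_add, h, h']⟩
      · obtain ⟨a, rfl⟩ := exists_formOf_eq hγ
        refine ⟨_, commutator_mem_L_two a (FreeAlgebra.ι ℂ i), ?_⟩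
        rw [formOf_commutator, formOf_ι, d_coord, d_dx_mul i (formOf_mem a)]
    obtain ⟨l, hl, h'⟩ := key
    exact ⟨l, hl, toForm_injective (h'.trans (h.trans hα))⟩

end Images

/-! ### The bracket on even forms with values in `A / L₃` -/

section Bracket

variable {n : ℕ}

/-- Since `[M₃, A] ⊆ L₃`, the commutator modulo `L₃` is a bilinear function of the associated
even forms. -/
theorem exists_bracket : ∃ br : Forms n →ₗ[ℂ] Forms n →ₗ[ℂ] (FreeAlg n ⧸ L ℂ (FreeAlg n) 3),
    ∀ a b, br (formOf n a) (formOf n b) = (L ℂ (FreeAlg n) 3).mkQ (a * b - b * a) := by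
  obtain ⟨s₀, hs₀⟩ := LinearMap.exists_rightInverse_of_surjective (phiTilde n).toLinearMap
    (LinearMap.range_eq_top.2 phiTilde_surjective)
  obtain ⟨s, hs⟩ := LinearMap.exists_extend (p := evenForms n)
    (show ↥(evenForms n) →ₗ[ℂ] FreeAlg n from s₀)
  -- `s` is a linear section of `φ̃` over the even forms
  have hs' : ∀ a : FreeAlg n, s (formOf n a) - a ∈ M ℂ (FreeAlg n) 3 := by
    intro a
    have h1 : s (formOf n a) = s₀ (phiTilde n a) := LinearMap.congr_fun hs (phiTilde n a)
    have h2 : phiTilde n (s₀ (phiTilde n a)) = phiTilde n a :=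
      LinearMap.congr_fun hs₀ (phiTilde n a)
    rw [← formOf_eq_zero_iff, formOf_apply, map_sub (phiTilde n), h1, h2, sub_self, map_zero]
  refine ⟨((LinearMap.mul ℂ (FreeAlg n) - (LinearMap.mul ℂ (FreeAlg n)).flip).compl₁₂ s s).compr₂
    (L ℂ (FreeAlg n) 3).mkQ, fun a b => ?_⟩
  have h1 := commutator_mem_L_three_of_mem_M_three (R := ℂ) (hs' a) (s (formOf n b))
  have h2 := commutator_mem_L_three_of_mem_M_three (R := ℂ) (hs' b) a
  simp only [LinearMap.compr₂_apply, LinearMap.compl₁₂_apply, LinearMap.sub_apply,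
    LinearMap.flip_apply, LinearMap.mul_apply', Submodule.mkQ_apply]
  rw [Submodule.Quotient.eq]
  convert sub_mem h1 h2 using 1
  noncomm_ring

variable {br : Forms n →ₗ[ℂ] Forms n →ₗ[ℂ] (FreeAlg n ⧸ L ℂ (FreeAlg n) 3)}
  (hbr : ∀ a b, br (formOf n a) (formOf n b) = (L ℂ (FreeAlg n) 3).mkQ (a * b - b * a))

include hbr

theorem bracket_skew {α β : Forms n} (hα : α ∈ evenForms n) (hβ : β ∈ evenForms n) :
    br α β = -br β α := by
  obtain ⟨a, rfl⟩ := exists_formOf_eq hα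
  obtain ⟨b, rfl⟩ := exists_formOf_eq hβ
  rw [hbr, hbr, ← map_neg, neg_sub]

theorem bracket_one {α : Forms n} (hα : α ∈ evenForms n) : br α 1 = 0 := by
  obtain ⟨a, rfl⟩ := exists_formOf_eq hα
  rw [← formOf_one, hbr, mul_one, one_mul, sub_self, map_zero]

theorem bracket_d_mul_d {α β γ : Forms n} (hα : α ∈ evenForms n) (hβ : β ∈ evenForms n)
    (hγ : γ ∈ evenForms n) : br α (d β * d γ) = 0 := by
  obtain ⟨a, rfl⟩ := exists_formOf_eq hα
  obtain ⟨b, rfl⟩ := exists_formOf_eq hβ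
  obtain ⟨c, rfl⟩ := exists_formOf_eq hγ
  rw [← formOf_commutator, hbr, Submodule.mkQ_apply, Submodule.Quotient.mk_eq_zero]
  exact commutator_mem_L_three a (commutator_mem_L_two b c)

theorem bracket_d_mul_d_left {α β γ : Forms n} (hα : α ∈ evenForms n) (hβ : β ∈ evenForms n)
    (hγ : γ ∈ evenForms n) : br (d β * d γ) α = 0 := by
  rw [bracket_skew hbr (d_mul_d_mem hβ hγ) hα, bracket_d_mul_d hbr hα hβ hγ, neg_zero]

/-- The bracket behaves as the pairing `(α, β) ↦ α dβ` of Kähler forms modulo exact ones. -/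
theorem bracket_mul {α β γ : Forms n} (hα : α ∈ evenForms n) (hβ : β ∈ evenForms n)
    (hγ : γ ∈ evenForms n) : br α (β * γ) = br (α * β) γ + br (α * γ) β := by
  rw [evenForms_comm hα γ]
  obtain ⟨a, rfl⟩ := exists_formOf_eq hα
  obtain ⟨b, rfl⟩ := exists_formOf_eq hβ
  obtain ⟨c, rfl⟩ := exists_formOf_eq hγ
  have h1 := hbr a (b * c)
  have h2 := hbr (a * b) c
  have h3 := hbr (c * a) b
  rw [formOf_mul, map_add, map_smul, bracket_d_mul_d hbr hα hβ hγ, smul_zero, add_zero] at h1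
  rw [formOf_mul, map_add, map_smul, LinearMap.add_apply, LinearMap.smul_apply,
    bracket_d_mul_d_left hbr hγ hα hβ, smul_zero, add_zero] at h2
  rw [formOf_mul, map_add, map_smul, LinearMap.add_apply, LinearMap.smul_apply,
    bracket_d_mul_d_left hbr hβ hγ hα, smul_zero, add_zero] at h3
  rw [h1, h2, h3, ← map_add]
  congr 1
  noncomm_ring

/-- For `θ = dx_k ∧ β` this is the antisymmetry of `[b [x_k, x_i], x_j]` in `i` and `j`,
where `b` is sent to `β`. -/
theorem bracket_dx_mul_swap (i j : Fin n) {θ : Forms n} (hθ : θ ∈ oddForms n) :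
    br (dx i * θ) (coord j) = -br (dx j * θ) (coord i) := by
  refine oddForms_induction
    (P := fun θ => br (dx i * θ) (coord j) = -br (dx j * θ) (coord i)) (by simp)
    (fun a b ha hb => ?_) (fun k α hα => ?_) hθ
  · rw [mul_add, mul_add, map_add, map_add, LinearMap.add_apply, LinearMap.add_apply, ha, hb,
      neg_add]
  · obtain ⟨a, rfl⟩ := exists_formOf_eq hα
    have h : ∀ i j : Fin n, br (dx i * (dx k * formOf n a)) (coord j) =
        -(L ℂ (FreeAlg n) 3).mkQ
          (a * (FreeAlgebra.ι ℂ k * FreeAlgebra.ι ℂ i - FreeAlgebra.ι ℂ i * FreeAlgebra.ι ℂ k) *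
            FreeAlgebra.ι ℂ j - FreeAlgebra.ι ℂ j *
            (a * (FreeAlgebra.ι ℂ k * FreeAlgebra.ι ℂ i -
              FreeAlgebra.ι ℂ i * FreeAlgebra.ι ℂ k))) := by
      intro i j
      have hneg : dx k * dx i * formOf n a = -(dx i * (dx k * formOf n a)) := by
        rw [dx_mul_dx k i, ← mul_assoc]
        exact neg_mul (dx i * dx k) _
      rw [← hbr, formOf_mul_commutator, formOf_ι, formOf_ι, formOf_ι, d_coord, d_coord,
        evenForms_comm (formOf_mem a), hneg, map_neg, LinearMap.neg_apply, neg_neg]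
    rw [h, h, neg_neg, neg_eq_iff_add_eq_zero, ← map_add, Submodule.mkQ_apply,
      Submodule.Quotient.mk_eq_zero]
    exact commutator_mul_commutator_add_swap_mem _ _ _ _

/-- The chain rule `α dβ = ∑ α ∂_iβ dx_i` for the bracket. -/
theorem sum_bracket_partialD {α β : Forms n} (hα : α ∈ evenForms n) (hβ : β ∈ evenForms n) :
    ∑ i, br (α * partialD i β) (coord i) = br α β := by
  -- by `bracket_mul` the chain rule passes to products, so it may be checked on generators
  have hmul : ∀ g ∈ evenForms n, ∀ β ∈ evenForms n,
      (∀ α ∈ evenForms n, ∑ i, br (α * partialD i g) (coord i) = br α g) →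
      (∀ α ∈ evenForms n, ∑ i, br (α * partialD i β) (coord i) = br α β) →
      ∀ α ∈ evenForms n, ∑ i, br (α * partialD i (g * β)) (coord i) = br α (g * β) := by
    intro g hg β hβ h1 h2 α hα
    rw [bracket_mul hbr hα hg hβ, ← h1 _ (evenForms_mul hα hβ), ← h2 _ (evenForms_mul hα hg),
      ← Finset.sum_add_distrib]
    refine Finset.sum_congr rfl fun i _ => ?_
    rw [partialD_mul, evenForms_comm (partialD_mem_evenForms i hg), mul_add, map_add,
      LinearMap.add_apply, mul_assoc, mul_assoc, add_comm]
  refine evenForms_generators_induction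
    (P := fun β => ∀ α ∈ evenForms n, ∑ i, br (α * partialD i β) (coord i) = br α β)
    ?_ ?_ ?_ ?_ ?_ hβ α hα
  · intro a b ha hb α hα
    simp only [map_add, mul_add, LinearMap.add_apply, Finset.sum_add_distrib, ha α hα, hb α hα]
  · intro c a ha α hα
    simp only [map_smul, mul_smul_comm, LinearMap.smul_apply, ← Finset.smul_sum, ha α hα]
  · intro α hα
    rw [bracket_one hbr hα]
    refine Finset.sum_eq_zero fun i _ => ?_
    rw [Algebra.TensorProduct.one_def, partialD_tmul]
    simp
  · intro i β hβ h
    refine hmul _ (coord_mem i) β hβ (fun α hα => ?_) h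
    rw [Finset.sum_eq_single i]
    · simp [partialD_coord]
    · intro j _ hj
      simp [partialD_coord, hj]
    · simp
  · intro i j β hβ h
    refine hmul _ (dx_mul_dx_mem i j) β hβ (fun α hα => ?_) h
    have h0 := bracket_d_mul_d hbr hα (coord_mem i) (coord_mem j)
    rw [d_coord, d_coord] at h0
    rw [h0]
    refine Finset.sum_eq_zero fun k _ => ?_
    rw [partialD_mul, partialD_dx, partialD_dx]
    simp

omit hbr in
theorem contract_mem_oddForms (i : Fin n) {α : Forms n} (hα : α ∈ evenForms n) :
    contract i α ∈ oddForms n := by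
  refine evenForms_induction (P := fun α => contract i α ∈ oddForms n) (by simp)
    (fun a b ha hb => by rw [map_add]; exact add_mem ha hb) (fun k α hα => ?_) hα
  cases k with
  | zero =>
    refine formsDeg_induction (P := fun α => contract i α ∈ oddForms n) (by simp)
      (fun a b ha hb => by rw [map_add]; exact add_mem ha hb) (fun p w hw => ?_) hα
    obtain ⟨r, rfl⟩ := Submodule.mem_one.1 (by simpa using hw)
    rw [contract_tmul]
    erw [CliffordAlgebra.contractLeft_algebraMap]
    simp
  | succ k => exact formsDeg_le_oddForms k (contract_mem i hα)

/-- The bracket `{α, x_i}` depends only on the odd form `dx_i ∧ α`. -/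
theorem exists_odd_functional : ∃ η : Forms n →ₗ[ℂ] (FreeAlg n ⧸ L ℂ (FreeAlg n) 3),
    ∀ i, ∀ α ∈ evenForms n, η (dx i * α) = br α (coord i) := by
  -- `η γ = k⁻¹ ∑ {ι_i γ, x_i}` for `γ` of degree `k`
  refine ⟨∑ i, br.flip (coord i) ∘ₗ contract i ∘ₗ rescale (fun _ k => ((k : ℂ))⁻¹),
    fun j α hα => ?_⟩
  refine evenForms_induction (P := fun α => (∑ i, br.flip (coord i) ∘ₗ contract i ∘ₗ
    rescale (fun _ k => ((k : ℂ))⁻¹)) (dx j * α) = br α (coord j)) (by simp)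
    (fun a b ha hb => by rw [mul_add, map_add, ha, hb, map_add, LinearMap.add_apply])
    (fun k α hα => ?_) hα
  have hα' := formsDeg_le_evenForms k hα
  have hdeg : dx j * α ∈ formsDeg n (2 * k + 1) := by
    rw [add_comm]; exact formsDeg_mul (dx_mem j) hα
  have hk : ((2 * k + 1 : ℕ) : ℂ) ≠ 0 := Nat.cast_ne_zero.2 (by omega)
  have hsum : ∑ i, br (contract i (dx j * α)) (coord i) =
      ((2 * k + 1 : ℕ) : ℂ) • br α (coord j) := by
    have h1 : ∀ i, br (contract i (dx j * α)) (coord i) =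
        (if i = j then br α (coord i) else 0) + br (dx i * contract i α) (coord j) := by
      intro i
      rw [contract_dx_mul, map_sub, LinearMap.sub_apply,
        bracket_dx_mul_swap hbr j i (contract_mem_oddForms i hα'), sub_neg_eq_add]
      split_ifs <;> simp
    rw [Finset.sum_congr rfl fun i _ => h1 i, Finset.sum_add_distrib, Finset.sum_ite_eq',
      if_pos (Finset.mem_univ j), ← LinearMap.sum_apply, ← map_sum, sum_dx_mul_contract hα,
      map_smul, LinearMap.smul_apply, Nat.cast_succ, add_smul, one_smul, add_comm]
  simp only [LinearMap.sum_apply, LinearMap.comp_apply, LinearMap.flip_apply]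
  rw [rescale_eq_smul (fun _ => rfl) hdeg]
  simp only [map_smul, LinearMap.smul_apply, ← Finset.smul_sum, hsum]
  rw [inv_smul_smul₀ hk]

omit hbr in
/-- `L₂ ∩ M₃ ⊆ L₃`. If `l = ∑ [a_i, b_i]` is killed by `φ̃`, then the odd form
`∑ φ̃(a_i) dφ̃(b_i)` is closed, hence exact, and so it is killed by the functional that sends it
to the class of `l` modulo `L₃`. -/
theorem mem_L_three {l : FreeAlg n} (hl : l ∈ L ℂ (FreeAlg n) 2)
    (hM : l ∈ M ℂ (FreeAlg n) 3) : l ∈ L ℂ (FreeAlg n) 3 := by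
  obtain ⟨br, hbr⟩ := exists_bracket (n := n)
  obtain ⟨η, hη⟩ := exists_odd_functional hbr
  have hηd : ∀ α ∈ evenForms n, ∀ β ∈ evenForms n, η (α * d β) = br α β := by
    intro α hα β hβ
    rw [← sum_bracket_partialD hbr hα hβ, d_apply, Finset.mul_sum, map_sum]
    refine Finset.sum_congr rfl fun i _ => ?_
    rw [← mul_assoc, even_mul_dx hα, mul_assoc,
      hη i _ (evenForms_mul hα (partialD_mem_evenForms i hβ))]
  have key : ∃ γ ∈ oddForms n, d γ = formOf n l ∧ η γ = (L ℂ (FreeAlg n) 3).mkQ l := by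
    clear hM
    rw [L_succ ℂ _ le_rfl] at hl
    induction hl using Submodule.span_induction with
    | mem c hc =>
      obtain ⟨a, b, -, rfl⟩ := hc
      refine ⟨formOf n a * d (formOf n b),
        evenForms_mul_odd (formOf_mem a) (d_mem_oddForms (formOf_mem b)), ?_, ?_⟩
      · rw [formOf_commutator, d_mul (formOf_mem a), d_d, mul_zero, add_zero]
      · rw [hηd _ (formOf_mem a) _ (formOf_mem b), hbr]
    | zero => exact ⟨0, zero_mem _, by simp, by simp⟩
    | add b c _ _ hb hc =>
      obtain ⟨β, h1, h2, h3⟩ := hb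
      obtain ⟨γ, h1', h2', h3'⟩ := hc
      exact ⟨β + γ, add_mem h1 h1', by rw [map_add, map_add, h2, h2'],
        by rw [map_add, map_add, h3, h3']⟩
    | smul r b _ hb =>
      obtain ⟨β, h1, h2, h3⟩ := hb
      exact ⟨r • β, Submodule.smul_mem _ _ h1, by rw [map_smul, map_smul, h2],
        by rw [map_smul, map_smul, h3]⟩
  obtain ⟨γ, hγ, hd, hηγ⟩ := key
  rw [formOf_eq_zero_iff.2 hM] at hd
  obtain ⟨δ, hδ, rfl⟩ := exists_even_of_d_eq_zero hγ hd
  have h1 : (1 : Forms n) ∈ evenForms n := one_mem_evenForms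
  rw [← one_mul (d δ), hηd 1 h1 δ hδ, bracket_skew hbr h1 hδ, bracket_one hbr hδ, neg_zero,
    eq_comm, Submodule.mkQ_apply, Submodule.Quotient.mk_eq_zero] at hηγ
  exact hηγ

end Bracket

/-! ### The quotients `B₂` and `B̄₁` -/

theorem L_two_inf_M_three (n : ℕ) :
    L ℂ (FreeAlg n) 2 ⊓ (M ℂ (FreeAlg n) 3).restrictScalars ℂ = L ℂ (FreeAlg n) 3 :=
  le_antisymm (fun _ h => mem_L_three h.1 h.2)
    (fun _ h => ⟨L_three_le_L_two h, L_le_M ℂ _ 3 h⟩)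

theorem range_BToQuot_two (n : ℕ) : LinearMap.range (BToQuot ℂ (FreeAlg n) 2) =
    (L ℂ (FreeAlg n) 2).map (Ideal.Quotient.mkₐ ℂ (M ℂ (FreeAlg n) 3)).toLinearMap := by
  rw [BToQuot, Submodule.range_liftQ, LinearMap.range_comp, Submodule.range_subtype]

theorem BToQuot_two_injective (n : ℕ) : Function.Injective (BToQuot ℂ (FreeAlg n) 2) := by
  rw [← LinearMap.ker_eq_bot, BToQuot, Submodule.ker_liftQ_eq_bot']
  ext ⟨l, hl⟩
  change l ∈ L ℂ (FreeAlg n) 3 ↔ Ideal.Quotient.mk (M ℂ (FreeAlg n) 3) l = 0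
  rw [Ideal.Quotient.eq_zero_iff_mem]
  exact ⟨fun h => L_le_M ℂ _ 3 h, fun h => mem_L_three hl h⟩

/-- The map `B₁ → Ω^even / Ω^even_exact` induced by `φ̃`. -/
def phiHat (n : ℕ) : B₁ ℂ (FreeAlg n) →ₗ[ℂ] EvenStar n ⧸ evenExact n :=
  (L ℂ (FreeAlg n) 2).liftQ ((evenExact n).mkQ ∘ₗ (phiTilde n).toLinearMap) fun l hl => by
    rw [LinearMap.mem_ker, LinearMap.comp_apply, Submodule.mkQ_apply,
      Submodule.Quotient.mk_eq_zero, ← map_L_two]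
    exact ⟨l, hl, rfl⟩

theorem phiHat_mkQ (n : ℕ) (a : FreeAlg n) :
    phiHat n ((L ℂ (FreeAlg n) 2).mkQ a) = (evenExact n).mkQ (phiTilde n a) := rfl

theorem ker_phiHat (n : ℕ) : LinearMap.ker (phiHat n) = Z ℂ (FreeAlg n) := by
  apply le_antisymm
  · intro b hb
    obtain ⟨a, rfl⟩ := Submodule.mkQ_surjective _ b
    rw [LinearMap.mem_ker, phiHat_mkQ, Submodule.mkQ_apply, Submodule.Quotient.mk_eq_zero,
      ← map_L_two] at hb
    obtain ⟨l, hl, h⟩ := hb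
    refine ⟨a - l, ?_, ?_⟩
    · change a - l ∈ M ℂ (FreeAlg n) 3
      rw [← formOf_eq_zero_iff, formOf_apply, map_sub (phiTilde n)]
      erw [h]
      rw [sub_self, map_zero]
    · rw [map_sub, sub_eq_self, Submodule.mkQ_apply, Submodule.Quotient.mk_eq_zero]
      exact hl
  · rintro _ ⟨a, ha, rfl⟩
    rw [LinearMap.mem_ker, phiHat_mkQ, phiTilde_eq_zero ha, map_zero]

end LowerCentral

end

theorem mainTheorem1 (n : ℕ) :
    -- the induced map `φ : A / M₃ → Ω_∗^even`, `x_i ↦ x_i`, is an algebra isomorphism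
    (∀ i, LowerCentral.phi n (Ideal.Quotient.mk _ (FreeAlgebra.ι ℂ i)) = LowerCentral.x i) ∧
    Function.Bijective (LowerCentral.phi n) ∧
    -- `φ(N₂)` is the space of even forms of positive degree
    (LowerCentral.N ℂ (LowerCentral.FreeAlg n) 2).map (LowerCentral.phi n).toLinearMap =
      LowerCentral.evenPos n ∧
    -- `L₂ ∩ M₃ = L₃`, and `B₂` is naturally isomorphic to the image of `L₂` in `A / M₃`
    LowerCentral.L ℂ (LowerCentral.FreeAlg n) 2 ⊓
        (LowerCentral.M ℂ (LowerCentral.FreeAlg n) 3).restrictScalars ℂ =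
      LowerCentral.L ℂ (LowerCentral.FreeAlg n) 3 ∧
    Function.Injective (LowerCentral.BToQuot ℂ (LowerCentral.FreeAlg n) 2) ∧
    LinearMap.range (LowerCentral.BToQuot ℂ (LowerCentral.FreeAlg n) 2) =
      (LowerCentral.L ℂ (LowerCentral.FreeAlg n) 2).map
        (Ideal.Quotient.mkₐ ℂ (LowerCentral.M ℂ (LowerCentral.FreeAlg n) 3)).toLinearMap ∧
    -- `φ(B₂)` is the space of even exact forms
    (LinearMap.range (LowerCentral.BToQuot ℂ (LowerCentral.FreeAlg n) 2)).map
        (LowerCentral.phi n).toLinearMap =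
      LowerCentral.evenExact n ∧
    -- `φ` induces a map `B₁ → Ω^even / Ω^even_exact` that kills `Z`, and the resulting map on
    -- `B₁ / Z` is an isomorphism
    ∃ (phiHat : LowerCentral.B₁ ℂ (LowerCentral.FreeAlg n) →ₗ[ℂ]
        LowerCentral.EvenStar n ⧸ LowerCentral.evenExact n)
      (hZ : LowerCentral.Z ℂ (LowerCentral.FreeAlg n) ≤ LinearMap.ker phiHat),
      (∀ a : LowerCentral.FreeAlg n, phiHat ((LowerCentral.L ℂ (LowerCentral.FreeAlg n) 2).mkQ a) =
        (LowerCentral.evenExact n).mkQ (LowerCentral.phi n (Ideal.Quotient.mk _ a))) ∧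
      Function.Bijective ((LowerCentral.Z ℂ (LowerCentral.FreeAlg n)).liftQ phiHat hZ) := by

  have hN : (LowerCentral.N ℂ (LowerCentral.FreeAlg n) 2).map (LowerCentral.phi n).toLinearMap =
      LowerCentral.evenPos n :=
    (LowerCentral.map_phi_map_mk _).trans LowerCentral.map_M_two
  have hL : (LinearMap.range (LowerCentral.BToQuot ℂ (LowerCentral.FreeAlg n) 2)).map
      (LowerCentral.phi n).toLinearMap = LowerCentral.evenExact n := by
    rw [LowerCentral.range_BToQuot_two]
    exact (LowerCentral.map_phi_map_mk _).trans LowerCentral.map_L_two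
  refine ⟨fun i => ?_, LowerCentral.phi_bijective, hN, LowerCentral.L_two_inf_M_three n,
    LowerCentral.BToQuot_two_injective n, LowerCentral.range_BToQuot_two n, hL,
    LowerCentral.phiHat n, (LowerCentral.ker_phiHat n).ge, fun a => ?_, ?_, ?_⟩
  · rw [LowerCentral.phi_mk, LowerCentral.phiTilde, FreeAlgebra.lift_ι_apply]
  · rw [LowerCentral.phiHat_mkQ, LowerCentral.phi_mk]
  · rw [← LinearMap.ker_eq_bot]
    exact Submodule.ker_liftQ_eq_bot _ _ _ (LowerCentral.ker_phiHat n).le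
  · rw [← LinearMap.range_eq_top, Submodule.range_liftQ, LinearMap.range_eq_top]
    intro q
    obtain ⟨α, rfl⟩ := Submodule.mkQ_surjective _ q
    obtain ⟨a, rfl⟩ := LowerCentral.phiTilde_surjective α
    exact ⟨_, LowerCentral.phiHat_mkQ n a⟩
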